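/- \textbf{Definitions.} Consider $\mathbb{C}[[b]]$-modules $E$ endowed with a $\mathbb{C}$-linear endomorphism $a$ such that $a\,S = S\,a + b^2 S'$ for all $S\in\mathbb{C}[[b]]$; submodules, quotients, direct sums and morphisms are understood to be compatible with both $\mathbb{C}[[b]]$ and $a$. Such an $E$ is an \emph{(a,b)-module} if it is free of finite rank over $\mathbb{C}[[b]]$; it has a \emph{simple pole} if $aE\subset bE$, and it is \emph{regular} if it embeds in a simple pole (a,b)-module. A submodule $F\subset E$ is \emph{normal} if $F\cap bE=bF$. For $\nu\in\mathbb{C}$ let $E_\nu=\mathbb{C}[[b]]\,e$ be the rank $1$ module with $a e=\nu\, b e$. For a finite set $\Lambda\subset\mathbb{Q}\cap\,]0,1]$, an integer $N\ge 0$ and a finite dimensional complex vector space $V$, let $$\Xi_\Lambda^{(N)}\otimes V=\bigoplus_{r\in\Lambda}\bigoplus_{j=0}^N\mathbb{C}[[b]]\,s^{r-1}(\mathrm{Log}\,s)^j\otimes V,$$ where $a$ is multiplication by $s$ and $b$ is the primitive in $s$ without constant. A \emph{fresco} is a module isomorphic to the submodule generated by one element of some $\Xi_\Lambda^{(N)}\otimes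 V$. A \emph{Jordan--H\"older (J-H.) sequence} of $E$ is a sequence $0=F_0\subset F_1\subset\dots\subset F_k=E$ of normal submodules with $F_j/F_{j-1}$ of rank $1$; when $F_j/F_{j-1}\simeq E_{\lambda_j}$ for $1\le j\le k$, the $\lambda_1,\dots,\lambda_k$ are its associated numbers. An (a,b)-module is \emph{semi-simple} if it embeds in a finite direct sum of regular (a,b)-modules of rank $1$. The \emph{semi-simple part} $S_1(E)$ of a fresco $E$ is the submodule of $E$ made of (equivalently, generated by) the elements $x\in E$ for which the submodule generated by $x$ is semi-simple. \textbf{Statement.} Let $E$ be a fresco, let $\lambda_1,\dots,\lambda_k$ be the numbers associated to any J-H. sequence of $E$, and let $\mu_1,\dots,\mu_d$ be the numbers associated to any J-H. sequence of $S_1(E)$. Then: (1) for each $j\in[1,k]$, there exists a normal submodule of rank $1$ of $E$ isomorphic to $E_{\lambda_j+j-1}$ if and only if there exists $i\in[1,d]$ with $\lambda_j+j-1=\mu_i+i-1$; (2) this gives all isomorphism classes of normal submodules of rank $1$ of $E$: each normal submodule of rank $1$ of $E$ is isomorphic to $E_{\lambda_j+j-1}$ for some $j\in[1,k]$ such that $\lambda_j+j-1=\mu_i+i-1$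 for some $i\in[1,d]$. -/

import Mathlib

/-- The ring `ℂ[[b]]`; the variable `b` is `PowerSeries.X`. -/
abbrev Cb : Type := PowerSeries ℂ

/-- The element `b` of `ℂ[[b]]`. -/
noncomputable abbrev bb : Cb := PowerSeries.X

/-- The derivative `S ↦ S'` on `ℂ[[b]]`. -/
noncomputable abbrev bderiv (S : Cb) : Cb := PowerSeries.derivative ℂ S

/-- An action of `a` on a `ℂ[[b]]`-module: an additive map with `a S = S a + b² S'` for every
`S ∈ ℂ[[b]]`. Constants `S` have `S' = 0`, so `a` is `ℂ`-linear; for `S = b` the relation reads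
`a b - b a = b²`. -/
class ABAction (E : Type*) [AddCommGroup E] [Module Cb E] where
  a : E →+ E
  a_smul : ∀ (S : Cb) (x : E), a (S • x) = S • a x + (bb ^ 2 * bderiv S) • x

/-- Isomorphism: a `ℂ[[b]]`-linear bijection that commutes with `a`. -/
def ABIso (E F : Type*) [AddCommGroup E] [Module Cb E] [ABAction E]
    [AddCommGroup F] [Module Cb F] [ABAction F] : Prop :=
  ∃ e : E ≃ₗ[Cb] F, ∀ x, e (ABAction.a x) = ABAction.a (e x)

/-- `E` embeds into `F`: there is an injective `ℂ[[b]]`-linear map that commutes with `a`. -/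
def ABEmbeds (E F : Type*) [AddCommGroup E] [Module Cb E] [ABAction E]
    [AddCommGroup F] [Module Cb F] [ABAction F] : Prop :=
  ∃ f : E →ₗ[Cb] F, Function.Injective f ∧ ∀ x, f (ABAction.a x) = ABAction.a (f x)

/-- An (a,b)-module: the underlying `ℂ[[b]]`-module is free of finite rank. -/
def IsABModule (E : Type*) [AddCommGroup E] [Module Cb E] [ABAction E] : Prop :=
  Module.Free Cb E ∧ Module.Finite Cb E

/-- Simple pole: `a E ⊆ b E`. -/
def IsSimplePole (E : Type*) [AddCommGroup E] [Module Cb E] [ABAction E] : Prop :=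
  ∀ x : E, ∃ y : E, ABAction.a x = bb • y

/-- A regular (a,b)-module: one that embeds into a simple pole (a,b)-module. -/
def IsRegularAB (E : Type*) [AddCommGroup E] [Module Cb E] [ABAction E] : Prop :=
  IsABModule E ∧ ∃ (G : Type) (_ : AddCommGroup G) (_ : Module Cb G) (_ : ABAction G),
    IsABModule G ∧ IsSimplePole G ∧ ABEmbeds E G

/-- The direct sum of finitely many modules (as a product), with `a` acting componentwise. -/
instance ABAction.instPi {ι : Type*} (M : ι → Type*) [∀ i, AddCommGroup (M i)]
    [∀ i, Module Cb (M i)] [∀ i, ABAction (M i)] : ABAction (∀ i, M i) where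
  a :=
    { toFun := fun x i => ABAction.a (x i)
      map_zero' := by funext i; simp
      map_add' := by intro x y; funext i; simp }
  a_smul S x := by
    funext i
    exact ABAction.a_smul S (x i)

/-- A semi-simple (a,b)-module: an (a,b)-module that embeds into a finite direct sum of regular
(a,b)-modules of rank 1. -/
def IsSemisimpleAB (E : Type*) [AddCommGroup E] [Module Cb E] [ABAction E] : Prop :=
  IsABModule E ∧
  ∃ (n : ℕ) (M : Fin n → Type) (_ : ∀ i, AddCommGroup (M i)) (_ : ∀ i, Module Cb (M i))
    (_ : ∀ i, ABAction (M i)),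
    (∀ i, IsRegularAB (M i) ∧ Module.finrank Cb (M i) = 1) ∧ ABEmbeds E (∀ i, M i)

/-- Submodules: `ℂ[[b]]`-submodules that are stable under `a`. -/
structure ABSubmodule (E : Type*) [AddCommGroup E] [Module Cb E] [ABAction E] extends
    Submodule Cb E where
  a_mem : ∀ x ∈ toSubmodule, ABAction.a x ∈ toSubmodule

namespace ABSubmodule

variable {E : Type*} [AddCommGroup E] [Module Cb E] [ABAction E]

instance instCoeSort : CoeSort (ABSubmodule E) (Type _) := ⟨fun F => F.toSubmodule⟩

/-- The restriction of `a` to a submodule. -/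
instance instABAction (F : ABSubmodule E) : ABAction F.toSubmodule where
  a :=
    { toFun := fun x => ⟨ABAction.a (x : E), F.a_mem x x.2⟩
      map_zero' := by ext; simp
      map_add' := by intro x y; ext; simp }
  a_smul S x := by
    ext
    exact ABAction.a_smul S (x : E)

/-- The action of `a` on the quotient by a submodule. -/
noncomputable instance instABActionQuotient (F : ABSubmodule E) : ABAction (E ⧸ F.toSubmodule) where
  a := QuotientAddGroup.map F.toSubmodule.toAddSubgroup F.toSubmodule.toAddSubgroup
    ABAction.a (fun x hx => F.a_mem x hx)
  a_smul S x := by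
    induction x using Submodule.Quotient.induction_on with
    | H x => exact congrArg (Submodule.Quotient.mk (p := F.toSubmodule)) (ABAction.a_smul S x)

/-- For submodules `F`, `G` of `E`, the submodule `F ∩ G` of the module `G`. -/
noncomputable def restrict (F G : ABSubmodule E) : ABSubmodule G where
  toSubmodule := F.toSubmodule.comap G.toSubmodule.subtype
  a_mem x hx := F.a_mem (x : E) hx

/-- The smallest submodule that contains the set `s`. -/
noncomputable def generate (s : Set E) : ABSubmodule E where
  toSubmodule := sInf {p | s ⊆ p ∧ ∀ x ∈ p, ABAction.a x ∈ p}
  a_mem x hx := by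
    rw [Submodule.mem_sInf] at hx ⊢
    exact fun p hp => hp.2 x (hx p hp)

/-- `F` is normal in `E`: `F ∩ b E = b F`. -/
def IsNormal (F : ABSubmodule E) : Prop :=
  (F.toSubmodule : Set E) ∩ Set.range (fun x : E => bb • x) =
    (fun x : E => bb • x) '' (F.toSubmodule : Set E)

end ABSubmodule

/-- The rank 1 module `E_ν`, free over `ℂ[[b]]` on a generator `e` with `a e = ν b e`.
The series `S` stands for `S e`. -/
def Elam (_ν : ℂ) : Type := Cb

namespace Elam

variable (ν : ℂ)

noncomputable instance instAddCommGroup : AddCommGroup (Elam ν) := inferInstanceAs (AddCommGroup Cb)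

noncomputable instance instModule : Module Cb (Elam ν) := inferInstanceAs (Module Cb Cb)

/-- The formula `a (S e) = (ν b S + b² S') e`. -/
noncomputable def act (S : Cb) : Cb := PowerSeries.C ν * bb * S + bb ^ 2 * bderiv S

theorem act_zero : act ν 0 = 0 := by simp [act]

theorem act_add (S T : Cb) : act ν (S + T) = act ν S + act ν T := by
  simp only [act, bderiv, map_add]
  ring

theorem act_mul (S T : Cb) : act ν (S * T) = S * act ν T + (bb ^ 2 * bderiv S) * T := by
  simp only [act, bderiv, Derivation.leibniz, smul_eq_mul]
  ring

noncomputable instance instABAction : ABAction (Elam ν) where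
  a := { toFun := act ν, map_zero' := act_zero ν, map_add' := act_add ν }
  a_smul := act_mul ν

end Elam

/-- The module `Ξ_Λ^{(N)} ⊗ ℂ^p` of asymptotic expansions
`∑ ℂ[[b]] s^{r-1} (Log s)^j ⊗ v_q` over `r ∈ Λ`, `0 ≤ j ≤ N`, `1 ≤ q ≤ p`, where `a` is the
multiplication by `s` and `b` the primitive without constant. An expansion is given by its
coefficients in `ℂ[[b]]` on the elements `e_{r,j} ⊗ v_q`, where `e_{r,j} = s^{r-1} (Log s)^j`. -/
def Xi (Λ : Finset ℚ) (N p : ℕ) : Type := Λ → Fin (N + 1) → Fin p → Cb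

namespace Xi

variable (Λ : Finset ℚ) (N p : ℕ)

noncomputable instance instAddCommGroup : AddCommGroup (Xi Λ N p) :=
  inferInstanceAs (AddCommGroup (Λ → Fin (N + 1) → Fin p → Cb))

noncomputable instance instModule : Module Cb (Xi Λ N p) :=
  inferInstanceAs (Module Cb (Λ → Fin (N + 1) → Fin p → Cb))

/-- The coefficient on `e_{r,j+1} ⊗ v_q`, which is zero for `j = N`. -/
noncomputable def next (f : Λ → Fin (N + 1) → Fin p → Cb) (r : Λ) (j : Fin (N + 1))
    (q : Fin p) : Cb :=
  if h : (j : ℕ) + 1 < N + 1 then f r ⟨(j : ℕ) + 1, h⟩ q else 0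

/-- As `s e_{r,j} = s^r (Log s)^j` is the primitive of `r e_{r,j} + j e_{r,j-1}`, one has
`a e_{r,j} = r b e_{r,j} + j b e_{r,j-1}`; with `a S = S a + b² S'` the coefficient of `a f`
on `e_{r,j}` is `r b f_{r,j} + b² f_{r,j}' + (j + 1) b f_{r,j+1}`. -/
noncomputable instance instABAction : ABAction (Xi Λ N p) where
  a :=
    { toFun := fun (f : Λ → Fin (N + 1) → Fin p → Cb) r j q =>
        PowerSeries.C (((r : ℚ) : ℂ)) * bb * f r j q + bb ^ 2 * bderiv (f r j q) +
          PowerSeries.C ((((j : ℕ) + 1 : ℕ)) : ℂ) * bb * next Λ N p f r j q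
      map_zero' := by
        funext r j q
        change PowerSeries.C (((r : ℚ) : ℂ)) * bb * (0 : Cb) + bb ^ 2 * bderiv (0 : Cb) +
          PowerSeries.C ((((j : ℕ) + 1 : ℕ)) : ℂ) * bb * next Λ N p (fun _ _ _ => 0) r j q = 0
        simp [next]
      map_add' := by
        intro (f : Λ → Fin (N + 1) → Fin p → Cb) (g : Λ → Fin (N + 1) → Fin p → Cb)
        funext r j q
        have hn : next Λ N p (f + g) r j q = next Λ N p f r j q + next Λ N p g r j q := by
          unfold next
          split_ifs <;> simp
        change PowerSeries.C (((r : ℚ) : ℂ)) * bb * (f r j q + g r j q) +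
            bb ^ 2 * bderiv (f r j q + g r j q) +
            PowerSeries.C ((((j : ℕ) + 1 : ℕ)) : ℂ) * bb * next Λ N p (f + g) r j q =
          (PowerSeries.C (((r : ℚ) : ℂ)) * bb * f r j q + bb ^ 2 * bderiv (f r j q) +
            PowerSeries.C ((((j : ℕ) + 1 : ℕ)) : ℂ) * bb * next Λ N p f r j q) +
          (PowerSeries.C (((r : ℚ) : ℂ)) * bb * g r j q + bb ^ 2 * bderiv (g r j q) +
            PowerSeries.C ((((j : ℕ) + 1 : ℕ)) : ℂ) * bb * next Λ N p g r j q)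
        rw [hn]
        simp only [bderiv, map_add]
        ring }
  a_smul := by
    intro S (f : Λ → Fin (N + 1) → Fin p → Cb)
    funext r j q
    have hn : next Λ N p (S • f) r j q = S * next Λ N p f r j q := by
      unfold next
      split_ifs <;> simp
    change PowerSeries.C (((r : ℚ) : ℂ)) * bb * (S * f r j q) +
        bb ^ 2 * bderiv (S * f r j q) +
        PowerSeries.C ((((j : ℕ) + 1 : ℕ)) : ℂ) * bb * next Λ N p (S • f) r j q =
      S * (PowerSeries.C (((r : ℚ) : ℂ)) * bb * f r j q + bb ^ 2 * bderiv (f r j q) +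
        PowerSeries.C ((((j : ℕ) + 1 : ℕ)) : ℂ) * bb * next Λ N p f r j q) +
      (bb ^ 2 * bderiv S) * f r j q
    rw [hn]
    simp only [bderiv, Derivation.leibniz, smul_eq_mul]
    ring

end Xi

/-- A fresco: a module isomorphic to the submodule generated by one element `φ` of
`Ξ_Λ^{(N)} ⊗ V`, for a finite set `Λ` of rationals in `]0,1]`, an integer `N ≥ 0` and a finite
dimensional complex vector space `V = ℂ^p`. -/
def IsFresco (E : Type*) [AddCommGroup E] [Module Cb E] [ABAction E] : Prop :=
  ∃ (Λ : Finset ℚ) (N p : ℕ) (φ : Xi Λ N p), (∀ r ∈ Λ, 0 < r ∧ r ≤ 1) ∧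
    ABIso E (ABSubmodule.generate {φ})

/-- The semi-simple part `S₁(E)`: the submodule made of (generated by) the elements `x` whose
cyclic submodule is semi-simple. -/
noncomputable def semisimplePart (E : Type*) [AddCommGroup E] [Module Cb E] [ABAction E] : ABSubmodule E :=
  ABSubmodule.generate {x : E | IsSemisimpleAB (ABSubmodule.generate {x})}

/-- `0 = F₀ ⊆ F₁ ⊆ ⋯ ⊆ F_k = E` is a Jordan-Hölder sequence of `E` whose associated numbers are
`lam 1, …, lam k`: the `F_j` are normal submodules and `F_j / F_{j-1}` is isomorphic to
`E_{lam j}` (so it has rank 1) for `1 ≤ j ≤ k`. -/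
structure IsJordanHolder {E : Type*} [AddCommGroup E] [Module Cb E] [ABAction E] (k : ℕ)
    (F : ℕ → ABSubmodule E) (lam : ℕ → ℂ) : Prop where
  bot : (F 0).toSubmodule = ⊥
  top : (F k).toSubmodule = ⊤
  mono : ∀ j ∈ Finset.Icc 1 k, (F (j - 1)).toSubmodule ≤ (F j).toSubmodule
  normal : ∀ j ≤ k, (F j).IsNormal
  quot : ∀ j ∈ Finset.Icc 1 k,
    ABIso (F j ⧸ ((F (j - 1)).restrict (F j)).toSubmodule) (Elam (lam j))


/-!
A Jordan-Hölder sequence of a cyclic module provides a basis `e_0, …, e_{k-1}` in which `a` is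
triangular, with the diagonal entries `λ_{i+1} b` and with invertible entries just above the
diagonal. Normal submodules of rank 1 are generated by the `x ∉ b E` with `a x = ν b x`. In the
basis, this equation expresses each coordinate of `x` by the preceding one: the first coordinate
is invertible, and the order in `b` of the coordinates climbs by exactly one at each step until
some `λ_j + j - 1` equals `ν`. As the coordinates vanish from the index `k` on, `ν` is one of
these numbers.

In `Ξ` the semi-simple elements are those without logarithms, and the derivation with respect to
`Log s` kills every eigenvector. So `S₁(E)` contains all the eigenvectors of `E`. It is cyclic,
since the kernel of a functional on a cyclic module is cyclic, and the argument above applies to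
it. Conversely, in a semi-simple module an element of minimal support is proportional to an
eigenvector, which gives eigenvectors with any prescribed last coordinate. Dividing by `b` and
subtracting eigenvectors of smaller support, one gets an eigenvector outside `b E` for each of
the numbers `μ_i + i - 1`.
-/

open ABAction (a)
open PowerSeries (C coeff constantCoeff)

theorem exists_isUnit_mul_eq_pow {S : Cb} (hS : S ≠ 0) :
    ∃ (u : Cb) (n : ℕ), IsUnit u ∧ u * S = bb ^ n := by
  obtain ⟨n, v, rfl⟩ := IsDiscreteValuationRing.eq_unit_mul_pow_irreducible hS
    (PowerSeries.X_prime (R := ℂ)).irreducible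
  exact ⟨↑v⁻¹, n, Units.isUnit _, by rw [Units.inv_mul_cancel_left]⟩

theorem isUnit_of_not_bb_dvd {S : Cb} (hS : ¬ bb ∣ S) : IsUnit S :=
  PowerSeries.isUnit_iff_constantCoeff.2 (isUnit_iff_ne_zero.2 (PowerSeries.X_dvd_iff.not.1 hS))

theorem bb_pow_mul_injective {m n : ℕ} {u v : Cb} (hu : IsUnit u) (hv : IsUnit v)
    (h : bb ^ m * u = bb ^ n * v) : m = n := by
  have hassoc : Associated (bb ^ m) (bb ^ n) := by
    rw [← associated_mul_isUnit_left_iff hu, h]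
    exact associated_mul_unit_left _ _ hv
  exact (pow_dvd_pow_iff PowerSeries.X_ne_zero PowerSeries.X_prime.not_isUnit).1 hassoc.dvd
    |>.antisymm <|
      (pow_dvd_pow_iff PowerSeries.X_ne_zero PowerSeries.X_prime.not_isUnit).1 hassoc.symm.dvd

theorem exists_bb_dvd_sub_C_mul {U : Cb} (hU : IsUnit U) (S : Cb) : ∃ γ : ℂ, bb ∣ S - C γ * U := by
  have hU₀ : constantCoeff U ≠ 0 := (PowerSeries.isUnit_iff_constantCoeff.1 hU).ne_zero
  refine ⟨constantCoeff S / constantCoeff U, PowerSeries.X_dvd_iff.2 ?_⟩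
  simp [hU₀]

namespace Elam

theorem act_eq_bb_mul (ν : ℂ) (S : Cb) : act ν S = bb * (C ν * S + bb * bderiv S) := by
  rw [act]
  ring

theorem act_one (ν : ℂ) : act ν 1 = C ν * bb := by
  simp [act]

theorem act_C_mul (ν c : ℂ) (S : Cb) : act ν (C c * S) = C c * act ν S := by
  simp [act_mul]

theorem act_sub_C_mul (ν μ : ℂ) (S : Cb) : act ν S - C μ * bb * S = act (ν - μ) S := by
  simp only [act, map_sub]
  ring

theorem act_pow_mul (ν : ℂ) (n : ℕ) (S : Cb) :
    act ν (bb ^ n * S) = bb ^ n * act (ν + n) S := by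
  have hpow : bb * bderiv (bb ^ n) = C (n : ℂ) * bb ^ n := by
    rw [bderiv, Derivation.leibniz_pow, PowerSeries.derivative_X]
    cases n with
    | zero => simp
    | succ n =>
      simp only [Nat.add_sub_cancel, smul_eq_mul, mul_one, nsmul_eq_mul, map_natCast]
      ring
  rw [act_mul, act, act, map_add]
  linear_combination bb * S * hpow

theorem act_pow (ν : ℂ) (n : ℕ) : act ν (bb ^ n) = C (ν + n) * bb * bb ^ n := by
  rw [← mul_one (bb ^ n), act_pow_mul, act_one]
  ring

theorem coeff_succ_act (ν : ℂ) (S : Cb) (m : ℕ) :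
    coeff (m + 1) (act ν S) = (ν + m) * coeff m S := by
  rw [act_eq_bb_mul, mul_comm bb, PowerSeries.coeff_succ_mul_X, map_add, PowerSeries.coeff_C_mul,
    add_mul]
  cases m with
  | zero => simp
  | succ m =>
    rw [mul_comm bb, PowerSeries.coeff_succ_mul_X, bderiv, PowerSeries.coeff_derivative]
    push_cast
    ring

theorem exists_isUnit_act_eq_bb_mul {ν : ℂ} (hν : ν ≠ 0) {S : Cb} (hS : IsUnit S) :
    ∃ v, IsUnit v ∧ act ν S = bb * v := by
  refine ⟨_, ?_, act_eq_bb_mul ν S⟩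
  have hS₀ : constantCoeff S ≠ 0 := (PowerSeries.isUnit_iff_constantCoeff.1 hS).ne_zero
  simpa [PowerSeries.isUnit_iff_constantCoeff, hν] using hS₀

theorem exists_isUnit_eq_pow_mul_of_act_eq_zero {ν : ℂ} {S : Cb} (hS : S ≠ 0)
    (h : act ν S = 0) : ∃ (n : ℕ) (v : Cb), IsUnit v ∧ S = bb ^ n * v ∧ ν = -n := by
  obtain ⟨n, v, rfl⟩ := IsDiscreteValuationRing.eq_unit_mul_pow_irreducible hS
    (PowerSeries.X_prime (R := ℂ)).irreducible
  refine ⟨n, v, v.isUnit, mul_comm _ _, ?_⟩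
  by_contra hν
  obtain ⟨w, hw, hvw⟩ := exists_isUnit_act_eq_bb_mul (mt eq_neg_of_add_eq_zero_left hν) v.isUnit
  rw [mul_comm, act_pow_mul, hvw] at h
  exact mul_ne_zero (pow_ne_zero n PowerSeries.X_ne_zero)
    (mul_ne_zero PowerSeries.X_ne_zero hw.ne_zero) h

/-- On each coefficient `act ν` is a scalar, so it has no Jordan block. -/
theorem eq_zero_of_act_eq_mul {ν c : ℂ} (hc : c ≠ 0) {S T : Cb} (hS : act ν S = 0)
    (hT : act ν T = C c * bb * S) : S = 0 := by
  ext m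
  have hSm : (ν + m) * coeff m S = 0 := by rw [← coeff_succ_act, hS, map_zero]
  have hTm : (ν + m) * coeff m T = c * coeff m S := by
    rw [← coeff_succ_act, hT, mul_assoc, PowerSeries.coeff_C_mul, mul_comm bb,
      PowerSeries.coeff_succ_mul_X]
  rcases mul_eq_zero.1 hSm with hm | hm
  · simpa [hm, hc] using hTm.symm
  · rw [hm, map_zero]

end Elam

section Morphisms

variable {E F G : Type*} [AddCommGroup E] [Module Cb E] [ABAction E]
  [AddCommGroup F] [Module Cb F] [ABAction F] [AddCommGroup G] [Module Cb G] [ABAction G]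

/-- A morphism of `ℂ[[b]]`-modules with an action of `a`: the `ℂ[[b]]`-linear map `f` commutes
with `a`. -/
def IsABHom (f : E →ₗ[Cb] F) : Prop := ∀ x, f (a x) = a (f x)

theorem IsABHom.comp {g : F →ₗ[Cb] G} {f : E →ₗ[Cb] F} (hg : IsABHom g) (hf : IsABHom f) :
    IsABHom (g ∘ₗ f) := fun x => (congrArg g (hf x)).trans (hg (f x))

theorem IsABHom.subtype (F : ABSubmodule E) : IsABHom F.toSubmodule.subtype := fun _ => rfl

theorem IsABHom.inclusion {F G : ABSubmodule E} (h : F.toSubmodule ≤ G.toSubmodule) :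
    IsABHom (Submodule.inclusion h) := fun _ => rfl

theorem IsABHom.a_mem_ker {f : E →ₗ[Cb] F} (hf : IsABHom f) :
    ∀ x ∈ LinearMap.ker f, a x ∈ LinearMap.ker f := fun x hx => by
  rw [LinearMap.mem_ker] at hx ⊢
  rw [hf, hx, map_zero]

namespace ABSubmodule

theorem subset_generate (s : Set E) : s ⊆ (generate s).toSubmodule := fun _ hx =>
  Submodule.mem_sInf.2 fun _ hp => hp.1 hx

theorem generate_le {s : Set E} {p : Submodule Cb E} (hs : s ⊆ p) (hp : ∀ y ∈ p, a y ∈ p) :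
    (generate s).toSubmodule ≤ p :=
  sInf_le ⟨hs, hp⟩

theorem mem_generate_self (x : E) : x ∈ (generate {x}).toSubmodule :=
  subset_generate _ rfl

theorem generate_singleton_le {x : E} {p : Submodule Cb E} (hx : x ∈ p) (hp : ∀ y ∈ p, a y ∈ p) :
    (generate {x}).toSubmodule ≤ p :=
  generate_le (Set.singleton_subset_iff.2 hx) hp

theorem generate_smul_le (S : Cb) (x : E) :
    (generate {S • x}).toSubmodule ≤ (generate {x}).toSubmodule :=
  generate_singleton_le (Submodule.smul_mem _ S (mem_generate_self x)) (generate {x}).a_mem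

theorem generate_smul_of_isUnit {u : Cb} (hu : IsUnit u) (x : E) :
    (generate {u • x}).toSubmodule = (generate {x}).toSubmodule := by
  obtain ⟨u, rfl⟩ := hu
  refine (generate_smul_le _ x).antisymm ?_
  have hx : (↑u⁻¹ : Cb) • (u : Cb) • x = x := by rw [← mul_smul, Units.inv_mul, one_smul]
  have hle := generate_smul_le (↑u⁻¹ : Cb) ((u : Cb) • x)
  rwa [hx] at hle

theorem map_generate {f : E →ₗ[Cb] F} (hf : IsABHom f) (x : E) :
    (generate {x}).toSubmodule.map f = (generate {f x}).toSubmodule := by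
  apply le_antisymm
  · rw [Submodule.map_le_iff_le_comap]
    exact generate_singleton_le (mem_generate_self (f x)) fun y hy => by
      rw [Submodule.mem_comap, hf]
      exact (generate {f x}).a_mem _ hy
  · refine generate_singleton_le ⟨x, mem_generate_self x, rfl⟩ ?_
    rintro _ ⟨y, hy, rfl⟩
    exact ⟨a y, (generate {x}).a_mem y hy, hf y⟩

theorem generate_eq_top_of_injective {f : E →ₗ[Cb] F} (hf : IsABHom f)
    (hinj : Function.Injective f) {x : E}
    (hx : (generate {f x}).toSubmodule = LinearMap.range f) :
    (generate {x}).toSubmodule = ⊤ :=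
  Submodule.map_injective_of_injective hinj <| by rw [map_generate hf, hx, Submodule.map_top]

theorem generate_a_sub_smul_eq {x : E} {g : Cb} {K : Submodule Cb E} (hKa : ∀ y ∈ K, a y ∈ K)
    (hKx : K ≤ (generate {x}).toSubmodule) (hK : a x - g • x ∈ K)
    (hdisj : Disjoint K (Submodule.span Cb {x})) :
    (generate {a x - g • x}).toSubmodule = K := by
  set P := generate {a x - g • x}
  have hPK : P.toSubmodule ≤ K := generate_singleton_le hK hKa
  have hstable : ∀ y ∈ P.toSubmodule ⊔ Submodule.span Cb {x},
      a y ∈ P.toSubmodule ⊔ Submodule.span Cb {x} := by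
    intro y hy
    obtain ⟨z, hz, w, hw, rfl⟩ := Submodule.mem_sup.1 hy
    obtain ⟨S, rfl⟩ := Submodule.mem_span_singleton.1 hw
    have haction : a (z + S • x) =
        (a z + S • (a x - g • x)) + (S * g + bb ^ 2 * bderiv S) • x := by
      rw [map_add, ABAction.a_smul, smul_sub, add_smul, mul_smul S]
      abel
    rw [haction]
    exact Submodule.add_mem_sup
      (add_mem (P.a_mem z hz) (Submodule.smul_mem _ S (mem_generate_self _)))
      (Submodule.smul_mem _ _ (Submodule.mem_span_singleton_self x))
  have hxP : (generate {x}).toSubmodule ≤ P.toSubmodule ⊔ Submodule.span Cb {x} :=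
    generate_singleton_le (Submodule.mem_sup_right (Submodule.mem_span_singleton_self x)) hstable
  calc
    P.toSubmodule = P.toSubmodule ⊔ Submodule.span Cb {x} ⊓ K := by
      rw [hdisj.symm.eq_bot, sup_bot_eq]
    _ = (P.toSubmodule ⊔ Submodule.span Cb {x}) ⊓ K := (sup_inf_assoc_of_le _ hPK).symm
    _ = K := inf_eq_right.2 (hKx.trans hxP)

end ABSubmodule

theorem ABIso.exists_injective_of_generate {x : F} (h : ABIso E (ABSubmodule.generate {x})) :
    ∃ ι : E →ₗ[Cb] F, IsABHom ι ∧ Function.Injective ι ∧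
      ∃ e : E, (ABSubmodule.generate {e}).toSubmodule = ⊤ := by
  obtain ⟨g, hg⟩ := h
  let ι := (ABSubmodule.generate {x}).toSubmodule.subtype ∘ₗ g.toLinearMap
  have hιa : IsABHom ι := (IsABHom.subtype _).comp hg
  have hι : Function.Injective ι := Subtype.val_injective.comp g.injective
  let e := g.symm ⟨x, ABSubmodule.mem_generate_self x⟩
  have hιe : ι e = x := congrArg Subtype.val (g.apply_symm_apply _)
  refine ⟨ι, hιa, hι, e, ABSubmodule.generate_eq_top_of_injective hιa hι ?_⟩
  rw [hιe, LinearMap.range_comp, LinearEquiv.range, Submodule.map_top, Submodule.range_subtype]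

end Morphisms

section Coordinates

variable {E : Type*} [AddCommGroup E] [Module Cb E] [ABAction E]

/-- The element `x` satisfies `a x = ν b x`, like the generator of `E_ν`. -/
def IsEigenvector (ν : ℂ) (x : E) : Prop := a x = (C ν * bb) • x

/-- An element with `a x = ν b x` outside `b E`; it is the generator of a normal submodule
isomorphic to `E_ν`. -/
def IsPrimitiveEigenvector (ν : ℂ) (x : E) : Prop := IsEigenvector ν x ∧ ¬ ∃ z, x = bb • z

/-- Coordinates on a cyclic module with a Jordan-Hölder sequence whose associated numbers are
`lam 1, …, lam k`: a `ℂ[[b]]`-basis `e_0, …, e_{k-1}` with `a e_0 = lam 1 b e_0` and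
`a e_i = lam (i + 1) b e_i + link (i - 1) e_{i-1}`, where the series `link i` are invertible.
Coordinates are sequences that vanish from the index `k` on. -/
structure FrescoCoordinates (E : Type*) [AddCommGroup E] [Module Cb E] [ABAction E] (k : ℕ)
    (lam : ℕ → ℂ) where
  coord : E →ₗ[Cb] ℕ → Cb
  link : ℕ → Cb
  injective : Function.Injective coord
  coord_eq_zero : ∀ x i, k ≤ i → coord x i = 0
  exists_coord_eq : ∀ R : ℕ → Cb, (∀ i, k ≤ i → R i = 0) → ∃ x, coord x = R
  isUnit_link : ∀ i, IsUnit (link i)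
  coord_a : ∀ x i, coord (a x) i = Elam.act (lam (i + 1)) (coord x i) + link i * coord x (i + 1)

theorem IsEigenvector.of_bb_smul [Module.IsTorsionFree Cb E] {ν : ℂ} {z : E}
    (h : IsEigenvector (ν + 1) (bb • z)) : IsEigenvector ν z := by
  have hderiv : bderiv bb = 1 := PowerSeries.derivative_X
  rw [IsEigenvector, ABAction.a_smul, hderiv, map_add, map_one] at h
  refine smul_right_injective E PowerSeries.X_ne_zero ((eq_sub_of_add_eq h).trans ?_)
  simp only [← mul_smul, ← sub_smul]
  congr 1
  ring

theorem IsEigenvector.sub_C_smul {ν : ℂ} {x y : E} (hx : IsEigenvector ν x)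
    (hy : IsEigenvector ν y) (c : ℂ) : IsEigenvector ν (x - (C c : Cb) • y) := by
  have hderiv : bderiv (C c) = 0 := by simp [bderiv]
  rw [IsEigenvector, map_sub, ABAction.a_smul, hx, hy, hderiv, mul_zero,
    zero_smul, add_zero, smul_sub, smul_comm (C c)]

namespace FrescoCoordinates

variable {k : ℕ} {lam : ℕ → ℂ}

theorem coord_smul (c : FrescoCoordinates E k lam) (S : Cb) (x : E) (i : ℕ) :
    c.coord (S • x) i = S * c.coord x i :=
  congrFun (map_smul c.coord S x) i

theorem not_exists_eq_bb_smul (c : FrescoCoordinates E k lam) {x : E} {i : ℕ}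
    (hx : IsUnit (c.coord x i)) : ¬ ∃ z, x = bb • z := by
  rintro ⟨z, rfl⟩
  rw [coord_smul] at hx
  exact PowerSeries.X_prime.not_isUnit (isUnit_of_mul_isUnit_left hx)

theorem exists_eq_bb_smul (c : FrescoCoordinates E k lam) {x : E}
    (hx : ∀ i < k, bb ∣ c.coord x i) : ∃ z, x = bb • z := by
  have hdvd : ∀ i, bb ∣ c.coord x i := fun i => by
    rcases lt_or_ge i k with hi | hi
    · exact hx i hi
    · rw [c.coord_eq_zero x i hi]
      exact dvd_zero bb
  choose R hR using hdvd
  obtain ⟨z, hz⟩ := c.exists_coord_eq R fun i hi =>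
    (mul_eq_zero.1 ((hR i).symm.trans (c.coord_eq_zero x i hi))).resolve_left
      PowerSeries.X_ne_zero
  exact ⟨z, c.injective <| funext fun i => by rw [coord_smul, hz, hR i]⟩

theorem link_mul_coord_succ (c : FrescoCoordinates E k lam) {ν : ℂ} {x : E}
    (hx : IsEigenvector ν x) (i : ℕ) :
    c.link i * c.coord x (i + 1) = -Elam.act (lam (i + 1) - ν) (c.coord x i) := by
  have h : c.coord (a x) i = (C ν * bb) * c.coord x i := by
    rw [hx, coord_smul]
  rw [c.coord_a] at h
  linear_combination h - Elam.act_sub_C_mul (lam (i + 1)) ν (c.coord x i)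

theorem exists_eq_bb_smul_of_bb_dvd_coord_zero (c : FrescoCoordinates E k lam) {ν : ℂ} {x : E}
    (hx : IsEigenvector ν x) (h₀ : bb ∣ c.coord x 0) : ∃ z, x = bb • z := by
  refine c.exists_eq_bb_smul fun i _ => ?_
  cases i with
  | zero => exact h₀
  | succ i =>
    rw [← (c.isUnit_link i).dvd_mul_left, c.link_mul_coord_succ hx, Elam.act_eq_bb_mul, dvd_neg]
    exact dvd_mul_right _ _

theorem isUnit_coord_zero (c : FrescoCoordinates E k lam) {ν : ℂ} {x : E}
    (hx : IsPrimitiveEigenvector ν x) : IsUnit (c.coord x 0) :=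
  isUnit_of_not_bb_dvd fun h₀ => hx.2 (c.exists_eq_bb_smul_of_bb_dvd_coord_zero hx.1 h₀)

theorem exists_isUnit_coord_eq (c : FrescoCoordinates E k lam) {ν : ℂ} {x : E}
    (hx : IsEigenvector ν x) (h₀ : IsUnit (c.coord x 0)) {n : ℕ}
    (hn : ∀ i < n, ν ≠ lam (i + 1) + i) : ∃ u, IsUnit u ∧ c.coord x n = bb ^ n * u := by
  induction n with
  | zero => exact ⟨_, h₀, by rw [pow_zero, one_mul]⟩
  | succ n ih =>
    obtain ⟨u, hu, hxu⟩ := ih fun i hi => hn i (hi.trans n.lt_succ_self)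
    have hνn : lam (n + 1) - ν + n ≠ 0 := fun h =>
      hn n n.lt_succ_self (by linear_combination -h)
    obtain ⟨v, hv, huv⟩ := Elam.exists_isUnit_act_eq_bb_mul hνn hu
    obtain ⟨w, hw⟩ := (c.isUnit_link n).exists_left_inv
    have hlink := c.link_mul_coord_succ hx n
    rw [hxu, Elam.act_pow_mul, huv] at hlink
    refine ⟨w * -v, (IsUnit.of_mul_eq_one _ hw).mul hv.neg, ?_⟩
    linear_combination w * hlink - c.coord x (n + 1) * hw

theorem exists_eq_of_isPrimitiveEigenvector (c : FrescoCoordinates E k lam) {ν : ℂ} {x : E}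
    (hx : IsPrimitiveEigenvector ν x) : ∃ j ∈ Finset.Icc 1 k, ν = lam j + j - 1 := by
  by_contra! h
  obtain ⟨u, hu, hxu⟩ := c.exists_isUnit_coord_eq hx.1 (c.isUnit_coord_zero hx) fun i hi => by
    simpa [add_sub_assoc] using h (i + 1) (Finset.mem_Icc.2 ⟨i.succ_pos, hi⟩)
  rw [c.coord_eq_zero x k le_rfl] at hxu
  exact mul_ne_zero (pow_ne_zero k PowerSeries.X_ne_zero) hu.ne_zero hxu.symm

theorem isTorsionFree (c : FrescoCoordinates E k lam) : Module.IsTorsionFree Cb E :=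
  c.injective.moduleIsTorsionFree _ (map_smul c.coord)

theorem exists_eq_add_natCast_of_coord_succ_eq_zero (c : FrescoCoordinates E k lam)
    {ν : ℂ} {x : E} (hx : IsEigenvector ν x) {j : ℕ} (hj : c.coord x j ≠ 0)
    (hj' : c.coord x (j + 1) = 0) :
    ∃ (s : ℕ) (v : Cb), IsUnit v ∧ c.coord x j = bb ^ s * v ∧ ν = lam (j + 1) + s := by
  have hact : Elam.act (lam (j + 1) - ν) (c.coord x j) = 0 := by
    rw [← neg_eq_zero, ← c.link_mul_coord_succ hx, hj', mul_zero]
  obtain ⟨s, v, hv, hxv, hν⟩ := Elam.exists_isUnit_eq_pow_mul_of_act_eq_zero hj hact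
  exact ⟨s, v, hv, hxv, by linear_combination -hν⟩

theorem exists_isEigenvector_of_bb_dvd_coord_zero (c : FrescoCoordinates E k lam) {j s : ℕ}
    {v : Cb} (hv : IsUnit v) {x : E} (hx : IsEigenvector (lam (j + 1) + s) x)
    (hxj : c.coord x j = bb ^ s * v) (h₀ : bb ∣ c.coord x 0) :
    ∃ t z, s = t + 1 ∧ x = bb • z ∧ IsEigenvector (lam (j + 1) + t) z ∧
      c.coord z j = bb ^ t * v := by
  have := c.isTorsionFree
  obtain ⟨z, rfl⟩ := c.exists_eq_bb_smul_of_bb_dvd_coord_zero hx h₀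
  rw [coord_smul] at hxj
  cases s with
  | zero =>
    rw [pow_zero, one_mul] at hxj
    exact absurd (isUnit_of_dvd_unit (Dvd.intro _ hxj) hv) PowerSeries.X_prime.not_isUnit
  | succ t =>
    rw [Nat.cast_succ, ← add_assoc] at hx
    rw [pow_succ', mul_assoc] at hxj
    exact ⟨t, z, rfl, rfl, hx.of_bb_smul, mul_left_cancel₀ PowerSeries.X_ne_zero hxj⟩

/-- Induction on the order `s` of the last coordinate: as long as `x` can be divided by `b`,
possibly after subtracting a multiple of an eigenvector of smaller support, `s` decreases. -/
theorem exists_isPrimitiveEigenvector_of_last (c : FrescoCoordinates E k lam) {j : ℕ}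
    (hlt : ∀ i < j, ∃ y, IsPrimitiveEigenvector (lam (i + 1) + i) y ∧
      ∀ m, i < m → c.coord y m = 0) {s : ℕ} {v : Cb} (hv : IsUnit v) {x : E}
    (hx : IsEigenvector (lam (j + 1) + s) x) (hxj : c.coord x j = bb ^ s * v)
    (hxm : ∀ m, j < m → c.coord x m = 0) :
    ∃ y, IsPrimitiveEigenvector (lam (j + 1) + j) y ∧ ∀ m, j < m → c.coord y m = 0 := by
  induction s using Nat.strong_induction_on generalizing x with
  | _ s ih =>
    have descent {w : E} (hw : IsEigenvector (lam (j + 1) + s) w)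
        (hwx : ∀ m, j ≤ m → c.coord w m = c.coord x m) (hw₀ : bb ∣ c.coord w 0) :
        ∃ y, IsPrimitiveEigenvector (lam (j + 1) + j) y ∧ ∀ m, j < m → c.coord y m = 0 := by
      obtain ⟨t, z, rfl, rfl, hz, hzj⟩ :=
        c.exists_isEigenvector_of_bb_dvd_coord_zero hv hw ((hwx j le_rfl).trans hxj) hw₀
      refine ih t t.lt_succ_self hz hzj fun m hm => ?_
      have hzm := (hwx m hm.le).trans (hxm m hm)
      exact (mul_eq_zero.1 (c.coord_smul bb z m ▸ hzm)).resolve_left PowerSeries.X_ne_zero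
    by_cases hν : ∃ i < j, lam (j + 1) + s = lam (i + 1) + (i : ℂ)
    · obtain ⟨i, hij, hν⟩ := hν
      obtain ⟨y, hy, hym⟩ := hlt i hij
      rw [← hν] at hy
      obtain ⟨γ, hγ⟩ := exists_bb_dvd_sub_C_mul (c.isUnit_coord_zero hy) (c.coord x 0)
      have hcoord (m : ℕ) :
          c.coord (x - (C γ : Cb) • y) m = c.coord x m - C γ * c.coord y m := by
        rw [map_sub, Pi.sub_apply, coord_smul]
      refine descent (hx.sub_C_smul hy.1 γ) (fun m hm => ?_) (hcoord 0 ▸ hγ)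
      rw [hcoord, hym m (hij.trans_le hm), mul_zero, sub_zero]
    by_cases hx₀ : bb ∣ c.coord x 0
    · exact descent hx (fun _ _ => rfl) hx₀
    have hx₀ := isUnit_of_not_bb_dvd hx₀
    push Not at hν
    obtain ⟨u, hu, hxu⟩ := c.exists_isUnit_coord_eq hx hx₀ hν
    obtain rfl := bb_pow_mul_injective hv hu (hxj.symm.trans hxu)
    exact ⟨x, ⟨hx, c.not_exists_eq_bb_smul hx₀⟩, hxm⟩

theorem exists_isPrimitiveEigenvector (c : FrescoCoordinates E k lam)
    (hlast : ∀ j < k, ∃ ν x, IsEigenvector ν x ∧ c.coord x j ≠ 0 ∧ ∀ m, j < m → c.coord x m = 0)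
    {j : ℕ} (hj : j < k) :
    ∃ x, IsPrimitiveEigenvector (lam (j + 1) + j) x ∧ ∀ m, j < m → c.coord x m = 0 := by
  induction j using Nat.strong_induction_on with
  | _ j ih =>
    obtain ⟨ν, x, hx, hxj, hxm⟩ := hlast j hj
    obtain ⟨s, v, hv, hxv, rfl⟩ :=
      c.exists_eq_add_natCast_of_coord_succ_eq_zero hx hxj (hxm _ j.lt_succ_self)
    exact c.exists_isPrimitiveEigenvector_of_last (fun i hi => ih i hi (hi.trans hj)) hv hx hxv hxm

end FrescoCoordinates

end Coordinates

theorem exists_equiv_prod {R K E : Type*} [Ring R] [AddCommGroup K] [Module R K] [AddCommGroup E]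
    [Module R E] {ι : K →ₗ[R] E} (hι : Function.Injective ι) {ψ : E →ₗ[R] R}
    (hker : LinearMap.range ι = LinearMap.ker ψ) {f : E} (hf : ψ f = 1) :
    ∃ e : (K × R) ≃ₗ[R] E, ∀ z S, e (z, S) = ι z + S • f := by
  have hψ : ∀ z, ψ (ι z) = 0 := fun z => LinearMap.mem_ker.1 (hker ▸ LinearMap.mem_range_self ι z)
  let g := ι.coprod (LinearMap.toSpanSingleton R E f)
  have hg : ∀ z S, g (z, S) = ι z + S • f := fun _ _ => rfl
  refine ⟨LinearEquiv.ofBijective g ⟨(injective_iff_map_eq_zero g).2 ?_, fun x => ?_⟩, hg⟩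
  · rintro ⟨z, S⟩ h
    rw [hg] at h
    have hS : S = 0 := by simpa [hψ, hf] using congrArg ψ h
    rw [hS, zero_smul, add_zero] at h
    exact Prod.ext (hι (h.trans (map_zero ι).symm)) hS
  · have hx : x - ψ x • f ∈ LinearMap.range ι := by
      rw [hker, LinearMap.mem_ker, map_sub, map_smul, hf, smul_eq_mul, mul_one, sub_self]
    obtain ⟨z, hz⟩ := hx
    exact ⟨(z, ψ x), by rw [hg, hz, sub_add_cancel]⟩

section JordanHolder

variable {E K : Type*} [AddCommGroup E] [Module Cb E] [ABAction E]
  [AddCommGroup K] [Module Cb K] [ABAction K]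

theorem isUnit_of_generate_eq_top {ν : ℂ} {ψ : E →ₗ[Cb] Cb} (hsurj : Function.Surjective ψ)
    (hψ : ∀ x : E, ψ (a x) = Elam.act ν (ψ x)) {x : E}
    (hx : (ABSubmodule.generate {x}).toSubmodule = ⊤) : IsUnit (ψ x) := by
  refine isUnit_of_not_bb_dvd fun hdvd => ?_
  have hle := ABSubmodule.generate_singleton_le (p := Submodule.comap ψ (Ideal.span {bb}))
    (Ideal.mem_span_singleton.2 hdvd) fun y _ => by
      rw [Submodule.mem_comap, hψ, Elam.act_eq_bb_mul]
      exact Ideal.mem_span_singleton.2 (dvd_mul_right _ _)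
  obtain ⟨y, hy⟩ := hsurj 1
  have hy' : bb ∣ ψ y := Ideal.mem_span_singleton.1 (hle (hx ▸ Submodule.mem_top))
  exact PowerSeries.X_prime.not_isUnit (isUnit_of_dvd_one (hy ▸ hy'))

theorem generate_a_sub_smul_eq_inf_ker {ν : ℂ} {ψ : E →ₗ[Cb] Cb} {x : E}
    (hψ : ∀ y ∈ (ABSubmodule.generate {x}).toSubmodule, ψ (a y) = Elam.act ν (ψ y)) {n : ℕ}
    (hx : ψ x = bb ^ n) :
    (ABSubmodule.generate {a x - (C (ν + n) * bb) • x}).toSubmodule =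
      (ABSubmodule.generate {x}).toSubmodule ⊓ LinearMap.ker ψ := by
  have hxmem := ABSubmodule.mem_generate_self x
  refine ABSubmodule.generate_a_sub_smul_eq (fun y hy => ⟨ABSubmodule.a_mem _ y hy.1, ?_⟩)
    inf_le_left ⟨sub_mem (ABSubmodule.a_mem _ x hxmem) (Submodule.smul_mem _ _ hxmem), ?_⟩ ?_
  · exact LinearMap.mem_ker.2 (by rw [hψ y hy.1, LinearMap.mem_ker.1 hy.2, Elam.act_zero])
  · refine LinearMap.mem_ker.2 ?_
    rw [map_sub, map_smul, hψ x hxmem, hx, Elam.act_pow, smul_eq_mul, sub_self]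
  · rw [Submodule.disjoint_def]
    intro y hy hyx
    obtain ⟨S, rfl⟩ := Submodule.mem_span_singleton.1 hyx
    have hS : S * bb ^ n = 0 := by rw [← hx, ← smul_eq_mul, ← map_smul, hy.2]
    rw [(mul_eq_zero.1 hS).resolve_right (pow_ne_zero n PowerSeries.X_ne_zero), zero_smul]

namespace FrescoCoordinates

variable {k : ℕ} {lam : ℕ → ℂ}

theorem nonempty_of_subsingleton [Subsingleton E] : Nonempty (FrescoCoordinates E 0 lam) :=
  ⟨0, fun _ => 1, Function.injective_of_subsingleton _, fun _ _ _ => rfl,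
    fun _ hR => ⟨0, funext fun i => (hR i i.zero_le).symm⟩, fun _ => isUnit_one,
    fun _ _ => by simp [Elam.act_zero]⟩

theorem nonempty_of_equiv (c : FrescoCoordinates K k lam) (e : E ≃ₗ[Cb] K)
    (he : IsABHom e.toLinearMap) : Nonempty (FrescoCoordinates E k lam) :=
  ⟨c.coord ∘ₗ e.toLinearMap, c.link, c.injective.comp e.injective, fun x => c.coord_eq_zero (e x),
    fun R hR => (c.exists_coord_eq R hR).elim fun z hz =>
      ⟨e.symm z, (congrArg c.coord (e.apply_symm_apply z)).trans hz⟩,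
    c.isUnit_link, fun x i => (congrFun (congrArg c.coord (he x)) i).trans (c.coord_a (e x) i)⟩

theorem exists_extend (c : FrescoCoordinates K k lam) (e : (K × Cb) ≃ₗ[Cb] E) {y : K}
    (ha : ∀ z S, a (e (z, S)) = e (a z + S • y, Elam.act (lam (k + 1)) S)) {u : Cb}
    (hu : IsUnit u) (hy : ∀ i, c.coord y i = if i + 1 = k then u else 0) :
    ∃ c' : FrescoCoordinates E (k + 1) lam,
      ∀ z S i, c'.coord (e (z, S)) i = c.coord z i + if i = k then S else 0 := by
  let coord : E →ₗ[Cb] ℕ → Cb :=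
    (c.coord ∘ₗ LinearMap.fst _ _ _ + LinearMap.single Cb (fun _ => Cb) k ∘ₗ
      LinearMap.snd _ _ _) ∘ₗ e.symm.toLinearMap
  have hcoord (z S i) : coord (e (z, S)) i = c.coord z i + if i = k then S else 0 := by
    simp [coord, Pi.single_apply]
  have hck (z) : c.coord z k = 0 := c.coord_eq_zero z k le_rfl
  refine ⟨⟨coord, fun i => if i + 1 = k then u else c.link i, (injective_iff_map_eq_zero _).2 ?_,
    ?_, fun R hR => ?_, fun i => ?_, ?_⟩, hcoord⟩
  · refine e.surjective.forall.2 ?_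
    rintro ⟨z, S⟩ h
    have hS : S = 0 := by simpa [hck, h] using (hcoord z S k).symm
    subst hS
    have hz : z = 0 := (map_eq_zero_iff _ c.injective).1 <| funext fun i => by
      simpa [h] using (hcoord z 0 i).symm
    rw [hz, ← map_zero e]
    rfl
  · refine e.surjective.forall.2 ?_
    rintro ⟨z, S⟩ i hi
    rw [hcoord, c.coord_eq_zero z i (k.le_succ.trans hi), if_neg (by lia), add_zero]
  · obtain ⟨z, hz⟩ := c.exists_coord_eq (Function.update R k 0) fun i hi => by
      rcases hi.eq_or_lt with rfl | hi
      · exact Function.update_self _ _ _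
      · rw [Function.update_of_ne hi.ne', hR i hi]
    refine ⟨e (z, R k), funext fun i => ?_⟩
    rw [hcoord, hz]
    rcases eq_or_ne i k with rfl | hi
    · simp
    · simp [hi]
  · split_ifs
    exacts [hu, c.isUnit_link i]
  · refine e.surjective.forall.2 ?_
    rintro ⟨z, S⟩ i
    rw [ha, hcoord, hcoord, hcoord, map_add, Pi.add_apply, c.coord_a, coord_smul, hy]
    rcases eq_or_ne i k with rfl | hi
    · simp [hck, Elam.act_zero, add_comm]
    rcases eq_or_ne (i + 1) k with rfl | hik
    · simp [hck, mul_comm]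
    · simp [hi, hik]

end FrescoCoordinates

theorem IsJordanHolder.exists_functional {k : ℕ} {F : ℕ → ABSubmodule E} {lam : ℕ → ℂ}
    (hF : IsJordanHolder k F lam) {j : ℕ} (hj : j < k) :
    ∃ ψ : F (j + 1) →ₗ[Cb] Cb, Function.Surjective ψ ∧
      (∀ x, ψ x = 0 ↔ (x : E) ∈ (F j).toSubmodule) ∧
      ∀ x, ψ (a x) = Elam.act (lam (j + 1)) (ψ x) := by
  obtain ⟨φ, hφ⟩ := hF.quot (j + 1) (Finset.mem_Icc.2 ⟨by lia, hj⟩)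
  let Q := ((F j).restrict (F (j + 1))).toSubmodule
  let φ' : (F (j + 1) ⧸ Q) ≃ₗ[Cb] Cb := φ.trans (LinearEquiv.refl Cb Cb : Elam _ ≃ₗ[Cb] Cb)
  refine ⟨φ'.toLinearMap ∘ₗ Q.mkQ, φ'.surjective.comp Q.mkQ_surjective, fun x => ?_,
    fun x => hφ (Submodule.Quotient.mk x)⟩
  rw [LinearMap.comp_apply, LinearEquiv.coe_coe, LinearEquiv.map_eq_zero_iff, Submodule.mkQ_apply,
    Submodule.Quotient.mk_eq_zero]
  rfl

theorem FrescoCoordinates.exists_of_ker {n : ℕ} {lam : ℕ → ℂ} {ι : K →ₗ[Cb] E}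
    (hιa : IsABHom ι) (hι : Function.Injective ι) {ψ : E →ₗ[Cb] Cb}
    (hsurj : Function.Surjective ψ) (hψ : ∀ x : E, ψ (a x) = Elam.act (lam (n + 1)) (ψ x))
    (hker : LinearMap.range ι = LinearMap.ker ψ)
    (hK : ∀ y : K, (ABSubmodule.generate {y}).toSubmodule = ⊤ →
      ∃ (c : FrescoCoordinates K n lam) (u : Cb), IsUnit u ∧
        ∀ i, c.coord y i = if i + 1 = n then u else 0)
    {x : E} (hx : (ABSubmodule.generate {x}).toSubmodule = ⊤) :
    ∃ (c : FrescoCoordinates E (n + 1) lam) (u : Cb), IsUnit u ∧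
      ∀ i, c.coord x i = if i + 1 = n + 1 then u else 0 := by
  have hψx := isUnit_of_generate_eq_top hsurj hψ hx
  obtain ⟨w, hw⟩ := hψx.exists_left_inv
  set f := w • x
  have hf : ψ f = 1 := by rw [map_smul, smul_eq_mul, hw]
  have hxf : x = ψ x • f := by rw [← mul_smul, mul_comm, hw, one_smul]
  have hfgen : (ABSubmodule.generate {f}).toSubmodule = ⊤ := by
    rw [ABSubmodule.generate_smul_of_isUnit (IsUnit.of_mul_eq_one _ hw), hx]
  have hpred : (ABSubmodule.generate {a f - (C (lam (n + 1)) * bb) • f}).toSubmodule =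
      LinearMap.ker ψ := by
    simpa only [Nat.cast_zero, add_zero, hfgen, top_inf_eq] using
      generate_a_sub_smul_eq_inf_ker (fun y _ => hψ y) (hf.trans (pow_zero bb).symm)
  obtain ⟨y, hy⟩ : a f - (C (lam (n + 1)) * bb) • f ∈ LinearMap.range ι :=
    hker ▸ hpred ▸ ABSubmodule.mem_generate_self _
  obtain ⟨c, u, hu, hyc⟩ := hK y <| ABSubmodule.generate_eq_top_of_injective hιa hι <| by
    rw [hy, hpred, hker]
  obtain ⟨e, he⟩ := exists_equiv_prod hι hker hf
  have hea (z : K) (S : Cb) : a (e (z, S)) = e (a z + S • y, Elam.act (lam (n + 1)) S) := by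
    rw [he, he, map_add, ABAction.a_smul, map_add, map_smul ι, hy, hιa, Elam.act, smul_sub,
      add_smul, mul_comm _ S, mul_smul S]
    abel
  obtain ⟨c', hc'⟩ := c.exists_extend e hea hu hyc
  refine ⟨c', ψ x, hψx, fun i => ?_⟩
  have hx' : x = e (0, ψ x) := by rw [he, map_zero, zero_add, ← hxf]
  rw [hx', hc', ← hx', map_zero, Pi.zero_apply, zero_add]
  exact if_congr Nat.add_right_cancel_iff.symm rfl rfl

theorem IsJordanHolder.exists_coordinates_of_generate {k : ℕ} {F : ℕ → ABSubmodule E}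
    {lam : ℕ → ℂ} (hF : IsJordanHolder k F lam) {j : ℕ} (hj : j ≤ k) (x : F j)
    (hx : (ABSubmodule.generate {x}).toSubmodule = ⊤) :
    ∃ (c : FrescoCoordinates (F j) j lam) (u : Cb), IsUnit u ∧
      ∀ i, c.coord x i = if i + 1 = j then u else 0 := by
  induction j with
  | zero =>
    have : Subsingleton (F 0).toSubmodule := hF.bot ▸ inferInstance
    obtain ⟨c⟩ := FrescoCoordinates.nonempty_of_subsingleton (E := F 0) (lam := lam)
    exact ⟨c, 1, isUnit_one, fun i => c.coord_eq_zero x i i.zero_le⟩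
  | succ j ih =>
    obtain ⟨ψ, hsurj, hker, hψ⟩ := hF.exists_functional hj
    have hle : (F j).toSubmodule ≤ (F (j + 1)).toSubmodule :=
      hF.mono (j + 1) (Finset.mem_Icc.2 ⟨by lia, hj⟩)
    refine FrescoCoordinates.exists_of_ker (IsABHom.inclusion hle)
      (Submodule.inclusion_injective hle) hsurj hψ ?_ (ih (by lia)) hx
    ext y
    rw [Submodule.range_inclusion, LinearMap.mem_ker, hker]
    rfl

theorem IsJordanHolder.nonempty_coordinates {k : ℕ} {F : ℕ → ABSubmodule E} {lam : ℕ → ℂ}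
    (hF : IsJordanHolder k F lam) {x : E} (hx : (ABSubmodule.generate {x}).toSubmodule = ⊤) :
    Nonempty (FrescoCoordinates E k lam) := by
  have hgen : (ABSubmodule.generate {(⟨x, hF.top ▸ Submodule.mem_top⟩ : F k)}).toSubmodule = ⊤ := by
    refine ABSubmodule.generate_eq_top_of_injective (IsABHom.subtype (F k)) Subtype.val_injective ?_
    rw [Submodule.range_subtype]
    exact hx.trans hF.top.symm
  obtain ⟨c, -⟩ := hF.exists_coordinates_of_generate le_rfl _ hgen
  exact c.nonempty_of_equiv (LinearEquiv.ofTop _ hF.top).symm fun _ => rfl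

end JordanHolder

section MinimalSupport

variable {E M : Type*} [AddCommGroup E] [Module Cb E] [ABAction E] [AddCommGroup M] [Module Cb M]
  [Module.IsTorsionFree Cb M]

theorem exists_smul_a_eq_smul_of_injective_pi {ι : Type*} [Finite ι] {f : E →ₗ[Cb] ι → Cb}
    (hf : Function.Injective f) (hfa : ∀ x i, f x i = 0 → f (a x) i = 0) {V : Submodule Cb E}
    (hVa : ∀ x ∈ V, a x ∈ V) {χ : E →ₗ[Cb] M} (hχ : ∃ x ∈ V, χ x ≠ 0) :
    ∃ x ∈ V, χ x ≠ 0 ∧ ∃ S T : Cb, T ≠ 0 ∧ T • a x = S • x := by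
  obtain ⟨x, ⟨hxV, hxχ⟩, hmin⟩ :=
    exists_minimalFor_of_wellFoundedLT (fun x => x ∈ V ∧ χ x ≠ 0) (fun x => (f x).support) hχ
  have hrel (i : ι) (hi : f x i ≠ 0) : f x i • χ (a x) = f (a x) i • χ x := by
    by_contra hne
    have hyχ : χ (f x i • a x - f (a x) i • x) ≠ 0 := by
      rwa [map_sub, map_smul, map_smul, sub_ne_zero]
    have hyV := V.sub_mem (V.smul_mem (f x i) (hVa x hxV)) (V.smul_mem (f (a x) i) hxV)
    refine hmin ⟨hyV, hyχ⟩ (fun m hm hxm => hm ?_) hi ?_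
    · simp [hxm, hfa x m hxm]
    · simp [mul_comm]
  obtain ⟨i, hi⟩ : ∃ i, f x i ≠ 0 := by
    by_contra! hzero
    have hx : x = 0 := (map_eq_zero_iff f hf).1 (funext hzero)
    exact hxχ (hx ▸ map_zero χ)
  refine ⟨x, hxV, hxχ, f (a x) i, f x i, hi, hf (funext fun m => ?_)⟩
  rw [map_smul, map_smul, Pi.smul_apply, Pi.smul_apply]
  rcases eq_or_ne (f x m) 0 with hm | hm
  · rw [hm, hfa x m hm, smul_zero, smul_zero]
  · refine smul_left_injective Cb hxχ ?_
    simp only [smul_eq_mul, mul_smul, ← hrel m hm]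
    rw [smul_comm, hrel i hi, smul_comm]

theorem IsSemisimpleAB.exists_smul_a_eq_smul (hE : IsSemisimpleAB E) {V : Submodule Cb E}
    (hVa : ∀ x ∈ V, a x ∈ V) {χ : E →ₗ[Cb] M} (hχ : ∃ x ∈ V, χ x ≠ 0) :
    ∃ x ∈ V, χ x ≠ 0 ∧ ∃ S T : Cb, T ≠ 0 ∧ T • a x = S • x := by
  obtain ⟨-, n, M, _, _, _, hM, f, hf, hfa⟩ := hE
  have hcoord (i) : Nonempty (M i ≃ₗ[Cb] Cb) := by
    obtain ⟨⟨⟨_, _⟩, -⟩, hrank⟩ := hM i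
    exact ⟨LinearEquiv.ofFinrankEq _ _ (hrank.trans (Module.finrank_self Cb).symm)⟩
  let g (i) : M i ≃ₗ[Cb] Cb := (hcoord i).some
  refine exists_smul_a_eq_smul_of_injective_pi
    (f := (LinearEquiv.piCongrRight g).toLinearMap ∘ₗ f)
    ((LinearEquiv.piCongrRight g).injective.comp hf) (fun x i hi => ?_) hVa hχ
  have hxi : f x i = 0 := (LinearEquiv.map_eq_zero_iff (g i)).1 hi
  refine (LinearEquiv.map_eq_zero_iff (g i)).2 ?_
  rw [hfa]
  exact (congrArg a hxi).trans (map_zero a)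

end MinimalSupport

theorem isEigenvector_map_iff {E F : Type*} [AddCommGroup E] [Module Cb E] [ABAction E]
    [AddCommGroup F] [Module Cb F] [ABAction F] {f : E →ₗ[Cb] F} (hf : IsABHom f)
    (hinj : Function.Injective f) {ν : ℂ} {x : E} :
    IsEigenvector ν (f x) ↔ IsEigenvector ν x := by
  rw [IsEigenvector, IsEigenvector, ← hf, ← map_smul, hinj.eq_iff]

namespace Xi

variable {Λ : Finset ℚ} {N p : ℕ}

instance : Module.IsTorsionFree Cb (Xi Λ N p) :=
  inferInstanceAs (Module.IsTorsionFree Cb (Λ → Fin (N + 1) → Fin p → Cb))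

instance : Module.Free Cb (Xi Λ N p) :=
  inferInstanceAs (Module.Free Cb (Λ → Fin (N + 1) → Fin p → Cb))

instance : Module.Finite Cb (Xi Λ N p) :=
  inferInstanceAs (Module.Finite Cb (Λ → Fin (N + 1) → Fin p → Cb))

@[ext]
theorem ext {f g : Xi Λ N p} (h : ∀ r j q, f r j q = g r j q) : f = g :=
  funext fun r => funext fun j => funext fun q => h r j q

@[simp]
theorem add_apply (f g : Xi Λ N p) (r j q) : (f + g) r j q = f r j q + g r j q :=
  rfl

@[simp]
theorem smul_apply (S : Cb) (f : Xi Λ N p) (r j q) : (S • f) r j q = S * f r j q :=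
  rfl

@[simp]
theorem zero_apply (r j q) : (0 : Xi Λ N p) r j q = 0 :=
  rfl

theorem a_apply (f : Xi Λ N p) (r : Λ) (j : Fin (N + 1)) (q : Fin p) :
    a f r j q = Elam.act (r : ℚ) (f r j q) + C ((j + 1 : ℕ) : ℂ) * bb * next Λ N p f r j q :=
  rfl

theorem next_castSucc (f : Xi Λ N p) (r : Λ) (j : Fin N) (q : Fin p) :
    next Λ N p f r j.castSucc q = f r j.succ q :=
  dif_pos (Nat.succ_lt_succ j.isLt)

theorem next_last (f : Xi Λ N p) (r : Λ) (q : Fin p) : next Λ N p f r (Fin.last N) q = 0 :=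
  dif_neg (lt_irrefl _)

theorem next_add (f g : Xi Λ N p) (r : Λ) (j : Fin (N + 1)) (q : Fin p) :
    next Λ N p (f + g) r j q = next Λ N p f r j q + next Λ N p g r j q := by
  unfold next
  split_ifs <;> simp

theorem next_smul (S : Cb) (f : Xi Λ N p) (r : Λ) (j : Fin (N + 1)) (q : Fin p) :
    next Λ N p (S • f) r j q = S * next Λ N p f r j q := by
  unfold next
  split_ifs <;> simp

variable (Λ N p) in
/-- The derivation with respect to `Log s`, which sends `s^{r-1} (Log s)^j` to
`j s^{r-1} (Log s)^{j-1}`. Its kernel consists of the expansions without logarithms. -/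
noncomputable def logD : Xi Λ N p →ₗ[Cb] Xi Λ N p where
  toFun f := fun r j q => C ((j + 1 : ℕ) : ℂ) * next Λ N p f r j q
  map_add' f g := by
    ext r j q : 1
    simp only [next_add, mul_add]
    rfl
  map_smul' S f := by
    ext r j q : 1
    simp only [next_smul, mul_left_comm]
    rfl

theorem logD_apply (f : Xi Λ N p) (r : Λ) (j : Fin (N + 1)) (q : Fin p) :
    logD Λ N p f r j q = C ((j + 1 : ℕ) : ℂ) * next Λ N p f r j q :=
  rfl

theorem isABHom_logD : IsABHom (logD Λ N p) := by
  intro f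
  ext r j q : 1
  rw [a_apply, logD_apply, logD_apply]
  cases j using Fin.lastCases with
  | last => simp only [next_last, mul_zero, Elam.act_zero, add_zero]
  | cast j =>
    simp only [next_castSucc, a_apply, logD_apply, Elam.act_C_mul, Fin.val_castSucc]
    ring

theorem logD_eq_zero_iff {f : Xi Λ N p} :
    logD Λ N p f = 0 ↔ ∀ r j q, next Λ N p f r j q = 0 := by
  have hC (j : Fin (N + 1)) : (C ((j + 1 : ℕ) : ℂ) : Cb) ≠ 0 :=
    (map_ne_zero_iff C PowerSeries.C_injective).2 (Nat.cast_ne_zero.2 (j : ℕ).succ_ne_zero)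
  simp only [Xi.ext_iff, logD_apply, zero_apply, mul_eq_zero, hC, false_or]

theorem exists_leading_coordinate {s : Set (Xi Λ N p)} (hs : ∃ f ∈ s, f ≠ 0) :
    ∃ r j q, (∃ f ∈ s, f r j q ≠ 0) ∧ ∀ f ∈ s, next Λ N p f r j q = 0 := by
  obtain ⟨f, hfs, hf⟩ := hs
  obtain ⟨r, j₀, q, hf₀⟩ : ∃ r j q, f r j q ≠ 0 := by
    by_contra! hzero
    exact hf (ext hzero)
  obtain ⟨j, hj, hmax⟩ :=
    exists_maximal_of_wellFoundedGT (fun j => ∃ f ∈ s, f r j q ≠ 0) ⟨j₀, f, hfs, hf₀⟩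
  refine ⟨r, j, q, hj, fun g hg => ?_⟩
  cases j using Fin.lastCases with
  | last => exact next_last g r q
  | cast j =>
    rw [next_castSucc]
    by_contra hne
    exact (hmax ⟨g, hg, hne⟩ (Fin.castSucc_lt_succ).le).not_gt Fin.castSucc_lt_succ

theorem isEigenvector_of_apply_eq_pow {x : Xi Λ N p} {S T : Cb} (hT : T ≠ 0)
    (h : T • a x = S • x) {r : Λ} {j : Fin (N + 1)} {q : Fin p} {n : ℕ} (hx : x r j q = bb ^ n)
    (hnext : next Λ N p x r j q = 0) : IsEigenvector (((r : ℚ) : ℂ) + n) x := by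
  have hcoord : T * Elam.act (r : ℚ) (bb ^ n) = S * bb ^ n := by
    simpa only [smul_apply, a_apply, hnext, mul_zero, add_zero, hx] using
      congrArg (fun f : Xi Λ N p => f r j q) h
  have hS : T * (C (((r : ℚ) : ℂ) + n) * bb) = S :=
    mul_right_cancel₀ (pow_ne_zero n PowerSeries.X_ne_zero) <| by
      rw [← hcoord, Elam.act_pow, mul_assoc]
  exact smul_right_injective _ hT <| h.trans <| by rw [← hS, mul_smul]

theorem exists_isUnit_isEigenvector_smul {x : Xi Λ N p} (hx : x ≠ 0) {S T : Cb} (hT : T ≠ 0)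
    (h : T • a x = S • x) : ∃ (u : Cb) (ν : ℂ), IsUnit u ∧ IsEigenvector ν (u • x) := by
  obtain ⟨r, j, q, ⟨_, rfl, hxr⟩, hnext⟩ := exists_leading_coordinate ⟨x, rfl, hx⟩
  obtain ⟨u, n, hu, hux⟩ := exists_isUnit_mul_eq_pow hxr
  refine ⟨u, _, hu, isEigenvector_of_apply_eq_pow (S := u * S + T * (bb ^ 2 * bderiv u))
    (mul_ne_zero hu.ne_zero hT) ?_ hux ?_⟩
  · rw [ABAction.a_smul, smul_add, mul_smul u T, smul_comm T u, h]
    simp only [← mul_smul, ← add_smul]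
    congr 1
    ring
  · rw [next_smul, hnext x rfl, mul_zero]

theorem logD_eq_zero_of_isEigenvector {ν : ℂ} {x : Xi Λ N p} (hx : IsEigenvector ν x) :
    logD Λ N p x = 0 := by
  have hact (r : Λ) (j : Fin (N + 1)) (q : Fin p) :
      Elam.act ((r : ℚ) - ν) (x r j q) = C (-(j + 1 : ℕ) : ℂ) * bb * next Λ N p x r j q := by
    have h : a x r j q = C ν * bb * x r j q := congrArg (fun f : Xi Λ N p => f r j q) hx
    rw [a_apply] at h
    rw [← Elam.act_sub_C_mul, map_neg]
    linear_combination h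
  refine logD_eq_zero_iff.2 fun r j q => ?_
  induction j using Fin.reverseInduction with
  | last => exact next_last x r q
  | cast j ih =>
    have hj := hact r j.castSucc q
    rw [next_castSucc] at hj ⊢
    refine Elam.eq_zero_of_act_eq_mul (neg_ne_zero.2 (Nat.cast_ne_zero.2 (Nat.succ_ne_zero _)))
      ?_ hj
    rw [hact, ih, mul_zero]

end Xi

section SemisimplePart

theorem Elam.isRegularAB (ν : ℂ) : IsRegularAB (Elam ν) := by
  have h : IsABModule (Elam ν) :=
    ⟨inferInstanceAs (Module.Free Cb Cb), inferInstanceAs (Module.Finite Cb Cb)⟩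
  exact ⟨h, Elam ν, _, _, _, h, fun S => ⟨_, Elam.act_eq_bb_mul ν S⟩, LinearMap.id,
    Function.injective_id, fun _ => rfl⟩

variable {E : Type*} [AddCommGroup E] [Module Cb E] [ABAction E] {Λ : Finset ℚ} {N p : ℕ}
  {ι : E →ₗ[Cb] Xi Λ N p}

theorem isABModule_of_injective (hι : Function.Injective ι) : IsABModule E :=
  ⟨Module.Free.of_equiv (LinearEquiv.ofInjective ι hι).symm, Module.Finite.of_injective ι hι⟩

theorem exists_isUnit_isEigenvector_smul (hιa : IsABHom ι) (hι : Function.Injective ι) {x : E}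
    (hx : x ≠ 0) {S T : Cb} (hT : T ≠ 0) (h : T • a x = S • x) :
    ∃ (u : Cb) (ν : ℂ), IsUnit u ∧ IsEigenvector ν (u • x) := by
  obtain ⟨u, ν, hu, hux⟩ := Xi.exists_isUnit_isEigenvector_smul ((map_ne_zero_iff ι hι).2 hx) hT
    (S := S) (by rw [← hιa, ← map_smul, h, map_smul])
  exact ⟨u, ν, hu, (isEigenvector_map_iff hιa hι).1 (by rwa [map_smul])⟩

theorem IsSemisimpleAB.logD_eq_zero (hE : IsSemisimpleAB E) (hιa : IsABHom ι)
    (hι : Function.Injective ι) (x : E) : Xi.logD Λ N p (ι x) = 0 := by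
  by_contra hx
  obtain ⟨y, -, hy, S, T, hT, h⟩ := hE.exists_smul_a_eq_smul (V := ⊤) (χ := Xi.logD Λ N p ∘ₗ ι)
    (fun _ _ => Submodule.mem_top) ⟨x, Submodule.mem_top, hx⟩
  obtain ⟨u, ν, hu, hν⟩ := exists_isUnit_isEigenvector_smul hιa hι (ne_zero_of_map hy) hT h
  have huy := Xi.logD_eq_zero_of_isEigenvector ((isEigenvector_map_iff hιa hι).2 hν)
  rw [map_smul, map_smul] at huy
  exact hy ((smul_eq_zero.1 huy).resolve_left hu.ne_zero)

theorem isSemisimpleAB_of_logD_eq_zero (hιa : IsABHom ι) (hι : Function.Injective ι)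
    (h : ∀ x, Xi.logD Λ N p (ι x) = 0) : IsSemisimpleAB E := by
  have hnext (x) := Xi.logD_eq_zero_iff.1 (h x)
  let σ := (Fintype.equivFin (Λ × Fin p)).symm
  refine ⟨isABModule_of_injective hι, _, fun i => Elam ((σ i).1 : ℚ), _, _, _,
    fun i => ⟨Elam.isRegularAB _, Module.finrank_self Cb⟩,
    { toFun := fun x i => ι x (σ i).1 0 (σ i).2
      map_add' := fun x y => by rw [map_add]; rfl
      map_smul' := fun S x => by rw [map_smul]; rfl }, fun x y hxy => hι ?_, fun x => ?_⟩
  · ext r j q : 1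
    cases j using Fin.cases with
    | zero =>
      obtain ⟨i, hi⟩ := σ.surjective (r, q)
      have hxyi : ι x (σ i).1 0 (σ i).2 = ι y (σ i).1 0 (σ i).2 := congrFun hxy i
      rwa [hi] at hxyi
    | succ j =>
      have hzero (z) : ι z r j.succ q = 0 :=
        (Xi.next_castSucc (ι z) r j q).symm.trans (hnext z _ _ _)
      exact (hzero x).trans (hzero y).symm
  · funext i
    change ι (a x) (σ i).1 0 (σ i).2 = Elam.act ((σ i).1 : ℚ) (ι x (σ i).1 0 (σ i).2)
    rw [hιa, Xi.a_apply, hnext, mul_zero, add_zero]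

theorem semisimplePart_toSubmodule (hιa : IsABHom ι) (hι : Function.Injective ι) :
    (semisimplePart E).toSubmodule = LinearMap.ker (Xi.logD Λ N p ∘ₗ ι) := by
  have hstable := (Xi.isABHom_logD.comp hιa).a_mem_ker
  apply le_antisymm
  · exact ABSubmodule.generate_le (fun x hx => hx.logD_eq_zero
      (hιa.comp (IsABHom.subtype (ABSubmodule.generate {x}))) (hι.comp Subtype.val_injective)
      ⟨x, ABSubmodule.mem_generate_self x⟩) hstable
  · intro x hx
    exact ABSubmodule.subset_generate _ <| isSemisimpleAB_of_logD_eq_zero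
      (hιa.comp (IsABHom.subtype (ABSubmodule.generate {x}))) (hι.comp Subtype.val_injective)
      fun z => ABSubmodule.generate_singleton_le hx hstable z.2

theorem mem_semisimplePart_iff (hιa : IsABHom ι) (hι : Function.Injective ι) {x : E} :
    x ∈ (semisimplePart E).toSubmodule ↔ Xi.logD Λ N p (ι x) = 0 := by
  rw [semisimplePart_toSubmodule hιa hι]
  rfl

theorem isSemisimpleAB_semisimplePart (hιa : IsABHom ι) (hι : Function.Injective ι) :
    IsSemisimpleAB (semisimplePart E) :=
  isSemisimpleAB_of_logD_eq_zero (hιa.comp (IsABHom.subtype _)) (hι.comp Subtype.val_injective)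
    fun x => (mem_semisimplePart_iff hιa hι).1 x.2

theorem exists_isPrimitiveEigenvector_semisimplePart_iff (hιa : IsABHom ι)
    (hι : Function.Injective ι) {ν : ℂ} :
    (∃ x : semisimplePart E, IsPrimitiveEigenvector ν x) ↔
      ∃ x : E, IsPrimitiveEigenvector ν x := by
  constructor
  · rintro ⟨x, hx, hprim⟩
    refine ⟨x, congrArg Subtype.val hx, ?_⟩
    rintro ⟨z, hz⟩
    have hbz := (mem_semisimplePart_iff hιa hι).1 x.2
    rw [hz, map_smul, map_smul] at hbz
    have hzS := (mem_semisimplePart_iff hιa hι).2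
      ((smul_eq_zero.1 hbz).resolve_left PowerSeries.X_ne_zero)
    exact hprim ⟨⟨z, hzS⟩, Subtype.ext hz⟩
  · rintro ⟨x, hx, hprim⟩
    have hxS := (mem_semisimplePart_iff hιa hι).2
      (Xi.logD_eq_zero_of_isEigenvector ((isEigenvector_map_iff hιa hι).2 hx))
    exact ⟨⟨x, hxS⟩, Subtype.ext hx, fun ⟨z, hz⟩ => hprim ⟨z, congrArg Subtype.val hz⟩⟩

theorem IsSemisimpleAB.exists_isEigenvector_of_last (hE : IsSemisimpleAB E) (hιa : IsABHom ι)
    (hι : Function.Injective ι) {k : ℕ} {lam : ℕ → ℂ} (c : FrescoCoordinates E k lam) {i : ℕ}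
    (hi : i < k) :
    ∃ ν x, IsEigenvector ν x ∧ c.coord x i ≠ 0 ∧ ∀ m, i < m → c.coord x m = 0 := by
  let V : Submodule Cb E := ⨅ m > i, LinearMap.ker (LinearMap.proj m ∘ₗ c.coord)
  have hV {x : E} : x ∈ V ↔ ∀ m, i < m → c.coord x m = 0 := by simp [V]
  have hVa : ∀ x ∈ V, a x ∈ V := fun x hx => hV.2 fun m hm => by
    rw [c.coord_a, hV.1 hx m hm, hV.1 hx (m + 1) (hm.trans m.lt_succ_self), Elam.act_zero,
      mul_zero, add_zero]
  obtain ⟨y, hy⟩ := c.exists_coord_eq (Pi.single i 1) fun m hm =>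
    Pi.single_eq_of_ne (hi.trans_le hm).ne' 1
  have hyV : y ∈ V := hV.2 fun m hm => by rw [hy, Pi.single_eq_of_ne hm.ne']
  have hyi : c.coord y i ≠ 0 := by rw [hy, Pi.single_eq_same]; exact one_ne_zero
  obtain ⟨x, hxV, hxi, S, T, hT, h⟩ :=
    hE.exists_smul_a_eq_smul (χ := LinearMap.proj i ∘ₗ c.coord) hVa ⟨y, hyV, hyi⟩
  obtain ⟨u, ν, hu, hν⟩ := exists_isUnit_isEigenvector_smul hιa hι (ne_zero_of_map hxi) hT h
  refine ⟨ν, u • x, hν, ?_, hV.1 (V.smul_mem u hxV)⟩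
  rw [c.coord_smul]
  exact mul_ne_zero hu.ne_zero hxi

theorem IsSemisimpleAB.exists_isPrimitiveEigenvector_iff (hE : IsSemisimpleAB E)
    (hιa : IsABHom ι) (hι : Function.Injective ι) {k : ℕ} {lam : ℕ → ℂ}
    (c : FrescoCoordinates E k lam) {ν : ℂ} :
    (∃ x : E, IsPrimitiveEigenvector ν x) ↔ ∃ j ∈ Finset.Icc 1 k, ν = lam j + j - 1 := by
  refine ⟨fun ⟨x, hx⟩ => c.exists_eq_of_isPrimitiveEigenvector hx, ?_⟩
  rintro ⟨j, hj, rfl⟩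
  obtain ⟨hj₁, hjk⟩ := Finset.mem_Icc.1 hj
  obtain ⟨i, rfl⟩ := Nat.exists_eq_add_of_le' hj₁
  obtain ⟨x, hx, -⟩ := c.exists_isPrimitiveEigenvector
    (fun _ hm => hE.exists_isEigenvector_of_last hιa hι c hm) (Nat.lt_of_succ_le hjk)
  exact ⟨x, by simpa [add_sub_assoc] using hx⟩

end SemisimplePart

section CyclicKernel

variable {E : Type*} [AddCommGroup E] [Module Cb E] [ABAction E]

theorem exists_generate_eq_inf_ker {ν : ℂ} {χ : E →ₗ[Cb] Cb} {x : E}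
    (hχ : ∀ y ∈ (ABSubmodule.generate {x}).toSubmodule, χ (a y) = Elam.act ν (χ y)) :
    ∃ f, (ABSubmodule.generate {f}).toSubmodule =
      (ABSubmodule.generate {x}).toSubmodule ⊓ LinearMap.ker χ := by
  rcases eq_or_ne (χ x) 0 with hx | hx
  · refine ⟨x, le_antisymm (ABSubmodule.generate_singleton_le
      ⟨ABSubmodule.mem_generate_self x, hx⟩
      fun y hy => ⟨ABSubmodule.a_mem _ y hy.1, LinearMap.mem_ker.2 ?_⟩) inf_le_left⟩
    rw [hχ y hy.1, LinearMap.mem_ker.1 hy.2, Elam.act_zero]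
  · obtain ⟨u, n, hu, hux⟩ := exists_isUnit_mul_eq_pow hx
    have hgen := ABSubmodule.generate_smul_of_isUnit hu x
    exact ⟨_, hgen ▸ generate_a_sub_smul_eq_inf_ker (hgen ▸ hχ) ((map_smul χ u x).trans hux)⟩

namespace Xi

variable {Λ : Finset ℚ} {N p : ℕ} {κ : E →ₗ[Cb] Xi Λ N p}

theorem exists_generate_eq_inf_ker (hκ : IsABHom κ) (e : E) :
    ∃ f, (ABSubmodule.generate {f}).toSubmodule =
      (ABSubmodule.generate {e}).toSubmodule ⊓ LinearMap.ker κ := by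
  let live (x : E) : Set (Λ × Fin (N + 1) × Fin p) :=
    {t | ∃ y ∈ (ABSubmodule.generate {x}).toSubmodule, κ y t.1 t.2.1 t.2.2 ≠ 0}
  induction hl : live e using WellFoundedLT.induction generalizing e with
  | _ l ih =>
    by_cases hzero : (ABSubmodule.generate {e}).toSubmodule ≤ LinearMap.ker κ
    · exact ⟨e, (inf_eq_left.2 hzero).symm⟩
    obtain ⟨y, hy, hκy⟩ := SetLike.not_le_iff_exists.1 hzero
    obtain ⟨r, j, q, ⟨_, ⟨z, hz, rfl⟩, hκz⟩, hnext⟩ :=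
      exists_leading_coordinate (s := κ '' (ABSubmodule.generate {e}).toSubmodule)
        ⟨_, Set.mem_image_of_mem κ hy, hκy⟩
    let χ : E →ₗ[Cb] Cb :=
      { toFun := fun x => κ x r j q
        map_add' := fun x y => by rw [map_add, add_apply]
        map_smul' := fun S x => by rw [map_smul, smul_apply]; rfl }
    have hχ (x) (hx : x ∈ (ABSubmodule.generate {e}).toSubmodule) :
        χ (a x) = Elam.act (r : ℚ) (χ x) := by
      change κ (a x) r j q = _
      rw [hκ, a_apply, hnext _ ⟨x, hx, rfl⟩, mul_zero, add_zero]
      rfl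
    obtain ⟨e', he'⟩ := _root_.exists_generate_eq_inf_ker hχ
    have hlt : live e' < l := by
      rw [← hl]
      have hsub : live e' ⊆ live e := fun t ⟨x, hx, hxt⟩ => ⟨x, (he'.le hx).1, hxt⟩
      refine (Set.ssubset_iff_of_subset hsub).2 ⟨(r, j, q), ⟨z, hz, hκz⟩, ?_⟩
      rintro ⟨x, hx, hxt⟩
      exact hxt (he'.le hx).2
    obtain ⟨f, hf⟩ := ih _ hlt e' rfl
    have hκχ : LinearMap.ker κ ≤ LinearMap.ker χ := fun x hx =>
      congrArg (fun g : Xi Λ N p => g r j q) hx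
    exact ⟨f, by rw [hf, he', inf_assoc, inf_eq_right.2 hκχ]⟩

end Xi

theorem exists_generate_semisimplePart_eq_top {Λ : Finset ℚ} {N p : ℕ} {ι : E →ₗ[Cb] Xi Λ N p}
    (hιa : IsABHom ι) (hι : Function.Injective ι) {e : E}
    (he : (ABSubmodule.generate {e}).toSubmodule = ⊤) :
    ∃ f : semisimplePart E, (ABSubmodule.generate {f}).toSubmodule = ⊤ := by
  obtain ⟨f, hf⟩ := Xi.exists_generate_eq_inf_ker (Xi.isABHom_logD.comp hιa) e
  rw [he, top_inf_eq, ← semisimplePart_toSubmodule hιa hι] at hf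
  refine ⟨⟨f, hf ▸ ABSubmodule.mem_generate_self f⟩, ?_⟩
  refine ABSubmodule.generate_eq_top_of_injective (IsABHom.subtype _) Subtype.val_injective ?_
  rw [Submodule.range_subtype]
  exact hf

end CyclicKernel

section RankOne

theorem eq_span_singleton_of_equiv {R M : Type*} [Semiring R] [AddCommMonoid M] [Module R M]
    {L : Submodule R M} (φ : L ≃ₗ[R] R) : L = Submodule.span R {(φ.symm 1 : M)} := by
  refine le_antisymm (fun y hy => Submodule.mem_span_singleton.2 ⟨φ ⟨y, hy⟩, ?_⟩)
    ((Submodule.span_singleton_le_iff_mem _ _).2 (φ.symm 1).2)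
  rw [← Submodule.coe_smul, ← map_smul, smul_eq_mul, mul_one, φ.symm_apply_apply]

variable {E : Type*} [AddCommGroup E] [Module Cb E] [ABAction E]

theorem IsEigenvector.abIso [Module.IsTorsionFree Cb E] {ν : ℂ} {L : ABSubmodule E} {x : E}
    (hx : IsEigenvector ν x) (hx₀ : x ≠ 0) (hL : L.toSubmodule = Submodule.span Cb {x}) :
    ABIso L (Elam ν) := by
  let e : Elam ν ≃ₗ[Cb] L := (LinearEquiv.toSpanNonzeroSingleton Cb E x hx₀).trans
    (LinearEquiv.ofEq _ _ hL.symm)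
  have hea : ∀ S : Elam ν, e (a S) = a (e S) := fun (S : Cb) => Subtype.ext <| by
    change Elam.act ν S • x = a (S • x)
    rw [ABAction.a_smul, hx, ← mul_smul, ← add_smul, Elam.act, mul_comm]
  exact ⟨e.symm, fun y => e.injective <| by rw [hea, e.apply_symm_apply, e.apply_symm_apply]⟩

theorem ABIso.exists_isEigenvector {ν : ℂ} {L : ABSubmodule E} (h : ABIso L (Elam ν)) :
    ∃ x : E, IsEigenvector ν x ∧ x ≠ 0 ∧ L.toSubmodule = Submodule.span Cb {x} := by
  obtain ⟨φ, hφ⟩ := h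
  let one : Elam ν := (1 : Cb)
  have hφx : φ (φ.symm one) = one := φ.apply_symm_apply one
  refine ⟨φ.symm one, congrArg Subtype.val (φ.injective ?_ : a (φ.symm one) = (C ν * bb) • _), ?_,
    eq_span_singleton_of_equiv (R := Cb) φ⟩
  · rw [hφ, map_smul, hφx]
    exact (Elam.act_one ν).trans (mul_one _).symm
  · intro h₀
    rw [(Subtype.ext h₀ : φ.symm one = 0), map_zero] at hφx
    exact zero_ne_one (α := Cb) hφx

theorem isNormal_iff_of_eq_span_singleton [Module.IsTorsionFree Cb E] {L : ABSubmodule E} {x : E}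
    (hx : x ≠ 0) (hL : L.toSubmodule = Submodule.span Cb {x}) :
    L.IsNormal ↔ ¬ ∃ z, x = bb • z := by
  have hxL : x ∈ L.toSubmodule := hL ▸ Submodule.mem_span_singleton_self x
  refine ⟨fun hn ⟨z, hz⟩ => ?_, fun hprim => Set.Subset.antisymm ?_ ?_⟩
  · obtain ⟨y, hy, hyx⟩ := hn.le ⟨hxL, z, hz.symm⟩
    obtain ⟨S, rfl⟩ := Submodule.mem_span_singleton.1 (hL ▸ hy)
    have hS : bb * S = 1 := smul_left_injective Cb hx (by simpa only [mul_smul, one_smul] using hyx)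
    exact PowerSeries.X_prime.not_isUnit (IsUnit.of_mul_eq_one S hS)
  · rintro _ ⟨hy, z, rfl⟩
    obtain ⟨S, hS⟩ := Submodule.mem_span_singleton.1 (hL ▸ hy)
    obtain ⟨T, rfl⟩ : bb ∣ S := by
      by_contra hndvd
      obtain ⟨u, rfl⟩ := isUnit_of_not_bb_dvd hndvd
      refine hprim ⟨(↑u⁻¹ : Cb) • z, ?_⟩
      rw [smul_comm, show bb • z = (u : Cb) • x from hS.symm, ← mul_smul, Units.inv_mul, one_smul]
    exact ⟨T • x, L.smul_mem T hxL, by rw [← hS, mul_smul]⟩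
  · rintro _ ⟨y, hy, rfl⟩
    exact ⟨L.smul_mem bb hy, y, rfl⟩

theorem exists_isPrimitiveEigenvector_of_isNormal [Module.IsTorsionFree Cb E] {ν : ℂ}
    {L : ABSubmodule E} (hn : L.IsNormal) (h : ABIso L (Elam ν)) :
    ∃ x : E, IsPrimitiveEigenvector ν x := by
  obtain ⟨x, hx, hx₀, hL⟩ := h.exists_isEigenvector
  exact ⟨x, hx, (isNormal_iff_of_eq_span_singleton hx₀ hL).1 hn⟩

theorem IsPrimitiveEigenvector.exists_isNormal [Module.IsTorsionFree Cb E] {ν : ℂ} {x : E}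
    (hx : IsPrimitiveEigenvector ν x) :
    ∃ L : ABSubmodule E, L.IsNormal ∧ Module.finrank Cb L = 1 ∧ ABIso L (Elam ν) := by
  have hx₀ : x ≠ 0 := fun h => hx.2 ⟨0, by rw [h, smul_zero]⟩
  have hstable : ∀ y ∈ Submodule.span Cb {x}, a y ∈ Submodule.span Cb {x} := fun y hy => by
    obtain ⟨S, rfl⟩ := Submodule.mem_span_singleton.1 hy
    rw [ABAction.a_smul, hx.1, ← mul_smul, ← add_smul]
    exact Submodule.smul_mem _ _ (Submodule.mem_span_singleton_self x)
  have hL : (⟨_, hstable⟩ : ABSubmodule E).toSubmodule = Submodule.span Cb {x} := rfl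
  have hiso := hx.1.abIso hx₀ hL
  refine ⟨_, (isNormal_iff_of_eq_span_singleton hx₀ hL).2 hx.2, ?_, hiso⟩
  obtain ⟨φ, -⟩ := hiso
  exact φ.finrank_eq.trans (Module.finrank_self Cb)

theorem exists_isNormal_abIso_iff [Module.IsTorsionFree Cb E] {ν : ℂ} :
    (∃ L : ABSubmodule E, L.IsNormal ∧ Module.finrank Cb L = 1 ∧ ABIso L (Elam ν)) ↔
      ∃ x : E, IsPrimitiveEigenvector ν x :=
  ⟨fun ⟨_, hn, _, hL⟩ => exists_isPrimitiveEigenvector_of_isNormal hn hL,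
    fun ⟨_, hx⟩ => hx.exists_isNormal⟩

theorem exists_abIso_Elam_of_finrank_eq_one {Λ : Finset ℚ} {N p : ℕ} {ι : E →ₗ[Cb] Xi Λ N p}
    (hιa : IsABHom ι) (hι : Function.Injective ι) {L : ABSubmodule E}
    (h : Module.finrank Cb L = 1) : ∃ ν : ℂ, ABIso L (Elam ν) := by
  have := hι.moduleIsTorsionFree ι (map_smul ι)
  have hιL : Function.Injective (ι ∘ₗ L.toSubmodule.subtype) := hι.comp Subtype.val_injective
  obtain ⟨_, _⟩ := isABModule_of_injective hιL
  let φ : L ≃ₗ[Cb] Cb := LinearEquiv.ofFinrankEq _ _ (h.trans (Module.finrank_self Cb).symm)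
  have hL := eq_span_singleton_of_equiv φ
  set x : E := ↑(φ.symm 1)
  have hx₀ : x ≠ 0 := fun h₀ =>
    one_ne_zero (φ.symm.map_eq_zero_iff.1 (Subtype.ext h₀ : φ.symm 1 = 0))
  obtain ⟨S, hS⟩ := Submodule.mem_span_singleton.1 (hL ▸ L.a_mem x (φ.symm 1).2)
  obtain ⟨u, ν, hu, hν⟩ := exists_isUnit_isEigenvector_smul hιa hι hx₀ one_ne_zero
    ((one_smul Cb (a x)).trans hS.symm)
  refine ⟨ν, hν.abIso (smul_ne_zero hu.ne_zero hx₀) ?_⟩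
  rwa [Submodule.span_singleton_smul_eq hu]

end RankOne

theorem mainTheorem10_general {E : Type*} [AddCommGroup E] [Module Cb E] [ABAction E]
    {Λ : Finset ℚ} {N p : ℕ} {φ : Xi Λ N p} (hE : ABIso E (ABSubmodule.generate {φ}))
    (k : ℕ) (F : ℕ → ABSubmodule E) (lam : ℕ → ℂ) (hF : IsJordanHolder k F lam)
    (d : ℕ) (G : ℕ → ABSubmodule (semisimplePart E)) (mu : ℕ → ℂ)
    (hG : IsJordanHolder d G mu) :
    (∀ j ∈ Finset.Icc 1 k,
      (∃ L : ABSubmodule E, L.IsNormal ∧ Module.finrank Cb L = 1 ∧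
          ABIso L (Elam (lam j + (j : ℂ) - 1))) ↔
        ∃ i ∈ Finset.Icc 1 d, lam j + (j : ℂ) - 1 = mu i + (i : ℂ) - 1) ∧
    (∀ L : ABSubmodule E, L.IsNormal → Module.finrank Cb L = 1 →
      ∃ j ∈ Finset.Icc 1 k, ABIso L (Elam (lam j + (j : ℂ) - 1)) ∧
        ∃ i ∈ Finset.Icc 1 d, lam j + (j : ℂ) - 1 = mu i + (i : ℂ) - 1) := by
  obtain ⟨ι, hιa, hι, e, he⟩ := hE.exists_injective_of_generate
  have := hι.moduleIsTorsionFree ι (map_smul ι)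
  obtain ⟨f, hf⟩ := exists_generate_semisimplePart_eq_top hιa hι he
  obtain ⟨c⟩ := hF.nonempty_coordinates he
  obtain ⟨c'⟩ := hG.nonempty_coordinates hf
  have hmu (ν : ℂ) :
      (∃ L : ABSubmodule E, L.IsNormal ∧ Module.finrank Cb L = 1 ∧ ABIso L (Elam ν)) ↔
        ∃ i ∈ Finset.Icc 1 d, ν = mu i + (i : ℂ) - 1 := by
    rw [exists_isNormal_abIso_iff, ← exists_isPrimitiveEigenvector_semisimplePart_iff hιa hι]
    exact (isSemisimpleAB_semisimplePart hιa hι).exists_isPrimitiveEigenvector_iff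
      (hιa.comp (IsABHom.subtype _)) (hι.comp Subtype.val_injective) c'
  refine ⟨fun j _ => hmu _, fun L hn hrk => ?_⟩
  obtain ⟨ν, hL⟩ := exists_abIso_Elam_of_finrank_eq_one hιa hι hrk
  obtain ⟨x, hx⟩ := exists_isPrimitiveEigenvector_of_isNormal hn hL
  obtain ⟨j, hj, rfl⟩ := c.exists_eq_of_isPrimitiveEigenvector hx
  exact ⟨j, hj, hL, (hmu _).1 ⟨L, hn, hrk, hL⟩⟩

theorem mainTheorem10 {E : Type*} [AddCommGroup E] [Module Cb E] [ABAction E]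
    (hE : IsFresco E)
    (k : ℕ) (F : ℕ → ABSubmodule E) (lam : ℕ → ℂ) (hF : IsJordanHolder k F lam)
    (d : ℕ) (G : ℕ → ABSubmodule (semisimplePart E)) (mu : ℕ → ℂ)
    (hG : IsJordanHolder d G mu) :
    (∀ j ∈ Finset.Icc 1 k,
      (∃ L : ABSubmodule E, L.IsNormal ∧ Module.finrank Cb L = 1 ∧
          ABIso L (Elam (lam j + (j : ℂ) - 1))) ↔
        ∃ i ∈ Finset.Icc 1 d, lam j + (j : ℂ) - 1 = mu i + (i : ℂ) - 1) ∧
    (∀ L : ABSubmodule E, L.IsNormal → Module.finrank Cb L = 1 →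
      ∃ j ∈ Finset.Icc 1 k, ABIso L (Elam (lam j + (j : ℂ) - 1)) ∧
        ∃ i ∈ Finset.Icc 1 d, lam j + (j : ℂ) - 1 = mu i + (i : ℂ) - 1) := by
  obtain ⟨_, _, _, _, -, hE⟩ := hE
  exact mainTheorem10_general hE k F lam hF d G mu hG
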